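/- **Setting.** Let $\mathcal S,\mathcal A$ be finite sets, $P(\cdot\mid s,a)$ a transition kernel, $R:\mathcal S\times\mathcal A\to[0,1]^q$ ($q\ge 2$) a reward function, $\pi(\cdot\mid s)$ a stationary policy, $\nu_0$ a reset distribution on $\mathcal S$, and $H\ge 1$ a horizon. Let $\rho$ be a (measurable) semimetric on $\mathbb R^q$ of strong negative type that is shift-invariant and $c_0$-homogeneous ($c_0>0$), and let $\kappa(x,y)=\tfrac12(\rho(x,z_0)+\rho(y,z_0)-\rho(x,y))$ be the kernel induced by $\rho$ with a base point $z_0$. For finitely supported signed measures put $\mathrm{MMD}_\kappa(\mu,\nu)=\bigl(\iint\kappa\,d(\mu-\nu)\,d(\mu-\nu)\bigr)^{1/2}$. For $1\le h\le H$ and $s\in\mathcal S$ let $\Theta_h(s)=\{\theta_{h,1}(s),\dots,\theta_{h,d}(s)\}\subset\mathbb R^q$ be a set of $d\ge1$ distinct points, let $\mathcal F_{h,s}$ be the set of signed measures $\sum_i p_i\delta_{\theta_{h,i}(s)}$ with $\sum_i p_i=1$, let $\Pi_{h,s}\nu$ be the minimizer of $\mathrm{MMD}_\kappa(\cdot,\nu)$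 over $\mathcal F_{h,s}$, and let $I_{h,s}\bigl(\sum_i p_i\delta_{\theta_{h,i}(s)}\bigr)=K_{h,s}^{1/2}p\in\mathbb R^d$, where $K_{h,s}=(\kappa(\theta_{h,i}(s),\theta_{h,j}(s)))_{i,j}$. For stacks $\eta=(\eta^h(s))_{1\le h\le H,\,s\in\mathcal S}$ put $\eta^0(s)=\delta_0$ and $$(T_H^\pi\eta)^h(s)=\sum_{a}\pi(a\mid s)\sum_{s'}P(s'\mid s,a)\,(z\mapsto R(s,a)+z)_\#\eta^{h-1}(s'),$$ let $\Pi_H$ and $I_H$ act as $\Pi_{h,s}$ and $I_{h,s}$ in each coordinate, fix $\lambda\in(0,1)$, and set $\ell_H(\eta,\eta')=\max_{1\le h\le H,\,s\in\mathcal S}\lambda^h\,\mathrm{MMD}_\kappa(\eta^h(s),\eta'^h(s))$. Sample i.i.d. episodes $(S_0,A_0,S_1,\dots,A_{H-1},S_H)$ with $S_0\sim\nu_0$, $A_t\sim\pi(\cdot\mid S_t)$, $S_{t+1}\sim P(\cdot\mid S_t,A_t)$, and assume $\rho_{\min}:=\min_{0\le t\le H-1,\,s\in\mathcal S}\Pr(S_t=s)>0$.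 Starting from a deterministic $\eta_0$ with $\eta_0^h(s)\in\mathcal F_{h,s}$ and $U_0=I_H(\eta_0)$, go through all the transitions, numbered $k=0,1,2,\dots$ ($H$ per episode). At transition $k$, from $s$ to $s'$ with reward $r$, put $\eta_k=I_H^{-1}(U_k)$ and, for all $h=1,\dots,H$, $$U_{k+1}^h(s)=U_k^h(s)+\alpha_k\Bigl(I_{h,s}\bigl(\Pi_{h,s}\bigl((z\mapsto r+z)_\#\eta_k^{h-1}(s')\bigr)\bigr)-U_k^h(s)\Bigr),$$ all the other blocks of $U_k$ being unchanged. **Theorem.** The operator $\Pi_HT_H^\pi$ has a unique fixed point $\eta^\star$, and there are constants $C,c,\bar\alpha>0$ with $cH\bar\alpha<1$, which depend on the above data but not on the step sizes, on $\eta_0$, or on the number of episodes, such that, with the thresholds $g(\alpha)=\max\{1,\alpha/\bar\alpha\}$ and $g(\alpha,z)=\max\{1,(\alpha/\bar\alpha)^{1/z},(2z/(c\alpha))^{1/(1-z)}\}$ and with $\tau_m=mH+g+H-1$, the following hold for all $m\ge0$. 1. If $\alpha_k\equiv\alpha$ with $0<\alpha\le\bar\alpha$, then $$\mathbb E\bigl[\ell_H(\eta_{mH},\eta^\star)^2\bigr]\le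 C\,\ell_H(\eta_0,\eta^\star)^2(1-cH\alpha)^m+C\alpha.$$ 2. If $\alpha_k=\alpha/(k+g)$ with $\alpha>1/c$ and $g\ge g(\alpha)$, then $$\mathbb E\bigl[\ell_H(\eta_{mH},\eta^\star)^2\bigr]\le C\,\ell_H(\eta_0,\eta^\star)^2\Bigl(\frac{\tau_0}{\tau_m}\Bigr)^{c\alpha}+\frac{C\alpha^2}{c\alpha-1}\cdot\frac1{\tau_m}.$$ 3. If $\alpha_k=\alpha/(k+g)^z$ with $\alpha>0$, $z\in(0,1)$ and $g\ge g(\alpha,z)$, then $$\mathbb E\bigl[\ell_H(\eta_{mH},\eta^\star)^2\bigr]\le C\,\ell_H(\eta_0,\eta^\star)^2\exp\Bigl(-\frac{c\alpha}{1-z}\bigl(\tau_m^{1-z}-\tau_0^{1-z}\bigr)\Bigr)+\frac{C\alpha}{\tau_m^z}.$$ -/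

import Mathlib

open MeasureTheory ProbabilityTheory

noncomputable section

namespace FixedHorizonMTD

/-! ### Semimetrics of strong negative type and the maximum mean discrepancy -/

/-- Reward and return vectors live in the Euclidean space `ℝ^q`. -/
abbrev Vec (q : ℕ) : Type := EuclideanSpace ℝ (Fin q)

/-- `ρ` is a semimetric on `ℝ^q` (a metric without the triangle inequality), measurable. -/
structure IsSemimetric {q : ℕ} (ρ : Vec q → Vec q → ℝ) : Prop where
  measurable : Measurable (Function.uncurry ρ)
  nonneg : ∀ x y, 0 ≤ ρ x y
  symm : ∀ x y, ρ x y = ρ y x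
  eq_zero_iff : ∀ x y, ρ x y = 0 ↔ x = y

/-- `ρ` is of strong negative type: it is of negative type, and
`∬ ρ d(P - Q) d(P - Q) < 0` for any two distinct Borel probability measures `P`, `Q` with a finite
`ρ`-moment. -/
structure IsStrongNegativeType {q : ℕ} (ρ : Vec q → Vec q → ℝ) : Prop where
  negative_type : ∀ (n : ℕ) (x : Fin n → Vec q) (a : Fin n → ℝ), ∑ i, a i = 0 →
    ∑ i, ∑ j, a i * a j * ρ (x i) (x j) ≤ 0
  strong : ∀ P Q : Measure (Vec q), IsProbabilityMeasure P → IsProbabilityMeasure Q →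
    (∃ z, Integrable (fun x => ρ x z) P) → (∃ z, Integrable (fun x => ρ x z) Q) → P ≠ Q →
    (∫ x, ∫ y, ρ x y ∂P ∂P) + (∫ x, ∫ y, ρ x y ∂Q ∂Q) - 2 * (∫ x, ∫ y, ρ x y ∂Q ∂P) < 0

/-- `ρ` is invariant under a common translation of its arguments. -/
def IsShiftInvariant {q : ℕ} (ρ : Vec q → Vec q → ℝ) : Prop :=
  ∀ v x y, ρ (x + v) (y + v) = ρ x y

/-- `ρ` is `c`-homogeneous. -/
def IsHomogeneous {q : ℕ} (c : ℝ) (ρ : Vec q → Vec q → ℝ) : Prop :=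
  ∀ a : ℝ, 0 < a → ∀ x y, ρ (a • x) (a • y) = a ^ c * ρ x y

/-- The kernel induced by the semimetric `ρ` with base point `z₀`. -/
def inducedKernel {q : ℕ} (ρ : Vec q → Vec q → ℝ) (z₀ : Vec q) (x y : Vec q) : ℝ :=
  (ρ x z₀ + ρ y z₀ - ρ x y) / 2

/-- Finitely supported signed measures on `ℝ^q`: `ν` stands for `∑ x, ν x • δ_x`. All measures
which occur in the algorithm and in the projected Bellman operator are of this form. -/
abbrev SignedLaw (q : ℕ) : Type := Vec q →₀ ℝ

/-- The maximum mean discrepancy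
`MMD_κ(μ, ν) = (∬ κ(x, y) d(μ - ν)(x) d(μ - ν)(y)) ^ (1 / 2)`. -/
def mmd {q : ℕ} (κ : Vec q → Vec q → ℝ) (μ ν : SignedLaw q) : ℝ :=
  Real.sqrt ((μ - ν).sum fun x a => (μ - ν).sum fun y b => a * b * κ x y)

/-- The Dirac mass at `x`. -/
def dirac {q : ℕ} (x : Vec q) : SignedLaw q := Finsupp.single x 1

/-- The push-forward of a signed law under `z ↦ r + z`. -/
def shift {q : ℕ} (r : Vec q) (ν : SignedLaw q) : SignedLaw q := ν.mapDomain fun z => r + z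

/-! ### Signed categorical laws, their MMD projection and their Gram-matrix embedding -/

/-- The signed measure `∑ i, p i • δ_{θ i}`. -/
def categorical {q d : ℕ} (θ : Fin d → Vec q) (p : Fin d → ℝ) : SignedLaw q :=
  ∑ i, p i • dirac (θ i)

/-- The signed categorical laws of total mass `1` supported on the points `θ i`. -/
def signedCategorical {q d : ℕ} (θ : Fin d → Vec q) : Set (SignedLaw q) :=
  {ν | ∃ p : Fin d → ℝ, ∑ i, p i = 1 ∧ ν = categorical θ p}

/-- `μ` is a nearest point to `ν`, in the MMD, among the mass-`1` signed categorical laws on `θ`. -/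
def IsProjection {q d : ℕ} (κ : Vec q → Vec q → ℝ) (θ : Fin d → Vec q) (ν μ : SignedLaw q) :
    Prop :=
  μ ∈ signedCategorical θ ∧ ∀ μ' ∈ signedCategorical θ, mmd κ μ ν ≤ mmd κ μ' ν

/-- The signed-categorical MMD projection: the minimizer of `mmd κ · ν` over `signedCategorical θ`
(it exists and is unique for the kernels and supports considered here). -/
def proj {q d : ℕ} (κ : Vec q → Vec q → ℝ) (θ : Fin d → Vec q) (ν : SignedLaw q) : SignedLaw q :=
  Classical.epsilon (IsProjection κ θ ν)

/-- The Gram matrix of the kernel on the support. -/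
def gram {q d : ℕ} (κ : Vec q → Vec q → ℝ) (θ : Fin d → Vec q) : Matrix (Fin d) (Fin d) ℝ :=
  Matrix.of fun i j => κ (θ i) (θ j)

open scoped MatrixOrder in
/-- The positive semidefinite square root of the Gram matrix. -/
def gramSqrt {q d : ℕ} (κ : Vec q → Vec q → ℝ) (θ : Fin d → Vec q) : Matrix (Fin d) (Fin d) ℝ :=
  CFC.sqrt (gram κ θ)

/-- The embedding `∑ i, p i • δ_{θ i} ↦ K^{1/2} p` (for distinct `θ i`, the weight `p i` is the mass
of the law at `θ i`). -/
def embed {q d : ℕ} (κ : Vec q → Vec q → ℝ) (θ : Fin d → Vec q) (ν : SignedLaw q) :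
    EuclideanSpace ℝ (Fin d) :=
  WithLp.toLp 2 (Matrix.mulVec (gramSqrt κ θ) fun i => ν (θ i))

/-- The inverse of `embed` on the embedded mass-`1` signed categorical laws. -/
def unembed {q d : ℕ} (κ : Vec q → Vec q → ℝ) (θ : Fin d → Vec q) (u : EuclideanSpace ℝ (Fin d)) :
    SignedLaw q :=
  Function.invFunOn (embed κ θ) (signedCategorical θ) u

/-! ### Horizon stacks

Index `i : Fin H` stands for the remaining horizon `h = i + 1 ∈ {1, …, H}`. -/

/-- A stack of signed laws, indexed by the horizons `1, …, H` and by the states. -/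
abbrev LawStack (H : ℕ) (S : Type*) (q : ℕ) : Type _ := Fin H → S → SignedLaw q

/-- A stack of embedded laws. -/
abbrev EmbStack (H : ℕ) (S : Type*) (d : ℕ) : Type _ := Fin H → S → EuclideanSpace ℝ (Fin d)

/-- The supports: `d` points of `ℝ^q` for each horizon and state. -/
abbrev Supports (H : ℕ) (S : Type*) (d q : ℕ) : Type _ := Fin H → S → Fin d → Vec q

/-- The stacks of mass-`1` signed categorical laws on the given supports. -/
def categoricalStacks {H d q : ℕ} {S : Type*} (Θ : Supports H S d q) : Set (LawStack H S q) :=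
  {η | ∀ i s, η i s ∈ signedCategorical (Θ i s)}

/-- The horizonwise and statewise embedding. -/
def embedStack {H d q : ℕ} {S : Type*} (κ : Vec q → Vec q → ℝ) (Θ : Supports H S d q)
    (η : LawStack H S q) : EmbStack H S d :=
  fun i s => embed κ (Θ i s) (η i s)

/-- The horizonwise and statewise inverse embedding. -/
def unembedStack {H d q : ℕ} {S : Type*} (κ : Vec q → Vec q → ℝ) (Θ : Supports H S d q)
    (U : EmbStack H S d) : LawStack H S q :=
  fun i s => unembed κ (Θ i s) (U i s)

/-- The layer one below the horizon `h = i + 1`: the terminal layer `δ_0` if `h = 1`, and the layer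
`h - 1` of the stack otherwise. -/
def below {H q : ℕ} {S : Type*} (η : LawStack H S q) (i : Fin H) (s : S) : SignedLaw q :=
  if i.val = 0 then dirac 0 else η ⟨i.val - 1, lt_of_le_of_lt (Nat.sub_le _ _) i.isLt⟩ s

/-- The weighted block metric `max_{h, s} λ^h MMD(η^h(s), η'^h(s))`. -/
def blockDist {H q : ℕ} {S : Type*} (κ : Vec q → Vec q → ℝ) (lam : ℝ) (η η' : LawStack H S q) :
    ℝ :=
  ⨆ x : Fin H × S, lam ^ (x.1.val + 1) * mmd κ (η x.1 x.2) (η' x.1 x.2)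

/-! ### The decision process, the Bellman operator and the sampled recursion -/

/-- A finite Markov decision process with reward function in `[0, 1]^q`. -/
structure MDP (S A : Type*) [Fintype S] (q : ℕ) where
  /-- The transition kernel `P(s' ∣ s, a)`. -/
  P : S → A → S → ℝ
  P_mem : ∀ s a, P s a ∈ stdSimplex ℝ S
  /-- The reward function. -/
  R : S → A → Vec q
  R_mem : ∀ s a j, R s a j ∈ Set.Icc (0 : ℝ) 1

/-- The undiscounted fixed-horizon distributional Bellman operator. -/
def bellman {H q : ℕ} {S A : Type*} [Fintype S] [Fintype A] (M : MDP S A q) (π : S → A → ℝ)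
    (η : LawStack H S q) : LawStack H S q :=
  fun i s => ∑ a, ∑ s', (π s a * M.P s a s') • shift (M.R s a) (below η i s')

/-- The projected Bellman operator. -/
def projBellman {H d q : ℕ} {S A : Type*} [Fintype S] [Fintype A] (κ : Vec q → Vec q → ℝ)
    (Θ : Supports H S d q) (M : MDP S A q) (π : S → A → ℝ) (η : LawStack H S q) :
    LawStack H S q :=
  fun i s => proj κ (Θ i s) (bellman M π η i s)

/-- The stacked sampled Bellman target for the transition from `s` to `s'` with reward `r`. -/
def sampledTarget {H d q : ℕ} {S : Type*} (κ : Vec q → Vec q → ℝ) (Θ : Supports H S d q)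
    (U : EmbStack H S d) (s : S) (r : Vec q) (s' : S) (i : Fin H) : EuclideanSpace ℝ (Fin d) :=
  embed κ (Θ i s) (proj κ (Θ i s) (shift r (below (unembedStack κ Θ U) i s')))

open Classical in
/-- One update with step size `a`: only the stack at the visited state `s` is changed. -/
def tdStep {H d q : ℕ} {S : Type*} (κ : Vec q → Vec q → ℝ) (Θ : Supports H S d q)
    (a : ℝ) (U : EmbStack H S d) (s : S) (r : Vec q) (s' : S) : EmbStack H S d :=
  fun i x => U i x + a • (if x = s then sampledTarget κ Θ U s r s' i - U i s else 0)

/-- An episode of length `H`: the states `S_0, …, S_H` and the actions `A_0, …, A_{H-1}`. -/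
abbrev Episode (H : ℕ) (S A : Type*) : Type _ := (Fin (H + 1) → S) × (Fin H → A)

/-- The iterates `U_k` along a sequence of episodes: the transition number `k` is the one at phase
`k % H` of the episode number `k / H`. -/
def iterate {H d q : ℕ} [NeZero H] {S A : Type*} [Fintype S] (κ : Vec q → Vec q → ℝ)
    (Θ : Supports H S d q) (M : MDP S A q) (α : ℕ → ℝ) (U₀ : EmbStack H S d)
    (ep : ℕ → Episode H S A) : ℕ → EmbStack H S d
  | 0 => U₀
  | k + 1 =>
    let e := ep (k / H)
    let t : Fin H := Fin.ofNat H k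
    tdStep κ Θ (α k) (iterate κ Θ M α U₀ ep k)
      (e.1 t.castSucc) (M.R (e.1 t.castSucc) (e.2 t)) (e.1 t.succ)

/-! ### Episodic sampling -/

/-- The probability of an episode: reset law `ν₀`, actions from `π`, transitions from the kernel. -/
def episodeProb {H q : ℕ} {S A : Type*} [Fintype S] (M : MDP S A q) (π : S → A → ℝ) (ν₀ : S → ℝ)
    (e : Episode H S A) : ℝ :=
  ν₀ (e.1 0) * ∏ t : Fin H,
    (π (e.1 t.castSucc) (e.2 t) * M.P (e.1 t.castSucc) (e.2 t) (e.1 t.succ))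

open Classical in
/-- The phase distribution `ρ_t(s)`: the probability that an episode is in state `s` at phase `t`. -/
def phaseLaw {H q : ℕ} {S A : Type*} [Fintype S] [Fintype A] (M : MDP S A q) (π : S → A → ℝ)
    (ν₀ : S → ℝ) (t : Fin H) (s : S) : ℝ :=
  ∑ e : Episode H S A, if e.1 t.castSucc = s then episodeProb M π ν₀ e else 0

/-- `ρ_min`, the minimum of `ρ_t(s)` over the phases `0 ≤ t ≤ H - 1` and the states. -/
def rhoMin (H : ℕ) {q : ℕ} {S A : Type*} [Fintype S] [Fintype A] (M : MDP S A q) (π : S → A → ℝ)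
    (ν₀ : S → ℝ) : ℝ :=
  ⨅ x : Fin H × S, phaseLaw M π ν₀ x.1 x.2

/-- The episodes `ep 0, ep 1, …` are i.i.d. with law `episodeProb`. -/
structure IsEpisodicSampling {H q : ℕ} {S A Ω : Type*} [Fintype S] [MeasurableSpace S]
    [MeasurableSpace A] [MeasurableSpace Ω] (M : MDP S A q) (π : S → A → ℝ) (ν₀ : S → ℝ)
    (μ : Measure Ω) (ep : ℕ → Ω → Episode H S A) : Prop where
  measurable : ∀ m, Measurable (ep m)
  indep : iIndepFun ep μ
  law : ∀ m e, μ.real (ep m ⁻¹' {e}) = episodeProb M π ν₀ e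

/-- The bound `E[X ^ 2] ≤ B`, including that the expectation is a genuine one. -/
def MeanSqLE {Ω : Type*} [MeasurableSpace Ω] (μ : Measure Ω) (X : Ω → ℝ) (B : ℝ) : Prop :=
  Integrable (fun ω => X ω ^ 2) μ ∧ ∫ ω, X ω ^ 2 ∂μ ≤ B

/-- The error `ℓ(η_{mH}, η⋆)` at the start of episode `m`, where `η_k = I⁻¹(U_k)` is generated from
`η₀` with the step sizes `α` along the given sequence of episodes. -/
def boundaryError {H d q : ℕ} [NeZero H] {S A : Type*} [Fintype S] (κ : Vec q → Vec q → ℝ)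
    (lam : ℝ) (Θ : Supports H S d q) (M : MDP S A q) (ηstar η₀ : LawStack H S q) (α : ℕ → ℝ)
    (ep : ℕ → Episode H S A) (m : ℕ) : ℝ :=
  blockDist κ lam (unembedStack κ Θ (iterate κ Θ M α (embedStack κ Θ η₀) ep (m * H))) ηstar

/-- The shifted clock `τ_m = m H + g + H - 1` at the start of episode `m`, for the step size
offset `g`. -/
def tau (H : ℕ) (g : ℝ) (m : ℕ) : ℝ := m * H + g + H - 1

end FixedHorizonMTD

end

/-!
The operator `Π_H T_H^π` computes the layer of horizon `h` from the layer `h - 1` alone, and the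
terminal layer is `δ_0`; so its fixed point exists and is unique by recursion on the horizon.

*Geometry.* Strong negative type makes `κ` positive definite on finitely supported signed laws of
mass zero (`IsStrongNegativeType.kernelForm_neg`), whatever the base point. On laws of mass one the
MMD projection is therefore the restriction of an affine map whose linear part is an orthogonal
projection (`IsMassZeroKernel.exists_proj_eq`), shifts are isometries, and `K^{1/2}` embeds the
categorical laws of mass one isometrically in a Euclidean space (`IsMassZeroKernel.norm_embed_sub`).
In the embedded space a sampled target is thus nonexpansive in the layer below and, because the
projection is affine, its mean at the fixed point given the visited state is the fixed point itself
(`IsMassZeroKernel.isSampledTarget`).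

*Drift of one episode.* The phases of an episode are dependent, so a whole episode is treated as one
step. Let `A` be the sum of its step sizes and `Δ` the error. Freezing the iterate at the beginning
of the episode costs `O(A²(‖Δ‖² + 1))`. In the remaining first order term the noise disappears by
the Markov property (`sum_pathWeight_transition`), and the block `(h, s)` is contracted at the rate
`ρ_t(s) ≥ ρ_min` and forced by the layer `h - 1` only. With the weights `δ ^ h`, where
`2 δ ≤ ρ_min`, the contraction dominates the forcing, and for small `A` the quadratic function
`lyapunov δ Δ` satisfies `E V' ≤ (1 - (δ / 2) A) V + B A²` (`IsSampledTarget.sum_lyapunov_le`). As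
the episodes are independent this holds for the expectations along the whole recursion
(`IsSampledTarget.integral_lyapunov_le`).

*Scalar recursions.* With `c = δ / 2`, and with `A` of the order of `H` times the last step size of
the episode (`stepSum_bounds`), the three bounds follow by comparison with explicit supersolutions
(`recursion_const`, `recursion_linear`, `recursion_poly`). Finally `lyapunov` and the squared block
metric are equivalent up to constants.
-/

noncomputable section

namespace FixedHorizonMTD

/-! ### The kernel on signed laws of mass zero -/

/-- The bilinear form `∬ κ(x, y) dμ(x) dν(y)` on signed laws. -/
def kernelForm {q : ℕ} (κ : Vec q → Vec q → ℝ) : SignedLaw q →ₗ[ℝ] SignedLaw q →ₗ[ℝ] ℝ :=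
  Finsupp.linearCombination ℝ fun x => Finsupp.linearCombination ℝ (κ x)

/-- The total mass of a signed law. -/
def mass {q : ℕ} : SignedLaw q →ₗ[ℝ] ℝ :=
  Finsupp.linearCombination ℝ fun _ => (1 : ℝ)

section Kernel

variable {q : ℕ}

lemma kernelForm_apply (κ : Vec q → Vec q → ℝ) (μ ν : SignedLaw q) :
    kernelForm κ μ ν = μ.sum fun x a => ν.sum fun y b => a * b * κ x y := by
  simp [kernelForm, Finsupp.linearCombination_apply, Finsupp.sum, LinearMap.sum_apply,
    Finset.mul_sum, mul_assoc]

@[simp]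
lemma kernelForm_single_single (κ : Vec q → Vec q → ℝ) (x y : Vec q) (a b : ℝ) :
    kernelForm κ (Finsupp.single x a) (Finsupp.single y b) = a * (b * κ x y) := by
  simp [kernelForm]

lemma mmd_eq_sqrt (κ : Vec q → Vec q → ℝ) (μ ν : SignedLaw q) :
    mmd κ μ ν = √(kernelForm κ (μ - ν) (μ - ν)) := by
  rw [mmd, kernelForm_apply]

@[simp]
lemma mass_single (x : Vec q) (a : ℝ) : mass (Finsupp.single x a) = a := by
  simp [mass]

@[simp]
lemma mass_dirac (x : Vec q) : mass (dirac x) = 1 := mass_single x 1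

@[simp]
lemma mass_shift (r : Vec q) (ν : SignedLaw q) : mass (shift r ν) = mass ν := by
  simp [mass, shift, Finsupp.linearCombination_mapDomain, Function.comp_def]

lemma shift_sub (r : Vec q) (μ ν : SignedLaw q) : shift r (μ - ν) = shift r μ - shift r ν :=
  map_sub (Finsupp.lmapDomain ℝ ℝ fun z => r + z) μ ν

/-- On laws of mass zero, the base point of the induced kernel plays no role. -/
lemma kernelForm_inducedKernel (ρ : Vec q → Vec q → ℝ) (z₀ : Vec q) (μ ν : SignedLaw q) :
    kernelForm (inducedKernel ρ z₀) μ ν =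
      (Finsupp.linearCombination ℝ (fun x => ρ x z₀) μ * mass ν
        + mass μ * Finsupp.linearCombination ℝ (fun x => ρ x z₀) ν - kernelForm ρ μ ν) / 2 := by
  induction μ using Finsupp.induction_linear with
  | zero => simp
  | add μ μ' h h' => simp only [map_add, LinearMap.add_apply, h, h']; ring
  | single x a =>
    induction ν using Finsupp.induction_linear with
    | zero => simp
    | add ν ν' h h' => simp only [map_add, h, h']; ring
    | single y b => simp [inducedKernel]; ring

lemma kernelForm_comm {κ : Vec q → Vec q → ℝ} (hκ : ∀ x y, κ x y = κ y x) (μ ν : SignedLaw q) :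
    kernelForm κ μ ν = kernelForm κ ν μ := by
  induction μ using Finsupp.induction_linear with
  | zero => simp
  | add μ μ' h h' => simp only [map_add, LinearMap.add_apply, h, h']
  | single x a =>
    induction ν using Finsupp.induction_linear with
    | zero => simp
    | add ν ν' h h' => simp only [map_add, LinearMap.add_apply, h, h']
    | single y b => simp [hκ x y]; ring

lemma kernelForm_shift {ρ : Vec q → Vec q → ℝ} (hρ : IsShiftInvariant ρ) (r : Vec q)
    (μ ν : SignedLaw q) : kernelForm ρ (shift r μ) (shift r ν) = kernelForm ρ μ ν := by
  have h : ∀ x y, ρ (r + x) (r + y) = ρ x y := fun x y => by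
    rw [add_comm r x, add_comm r y, hρ]
  simp only [kernelForm_apply, shift]
  rw [Finsupp.sum_mapDomain_index (by simp) (by intros; simp [add_mul])]
  refine Finsupp.sum_congr fun x _ => ?_
  rw [Finsupp.sum_mapDomain_index (by simp) (by intros; simp [mul_add, add_mul])]
  simp [h]

/-- The finitely supported measure with mass `w x` at the points `x` of `s`. -/
def discreteMeasure (s : Finset (Vec q)) (w : Vec q → ℝ) : Measure (Vec q) :=
  ∑ x ∈ s, ENNReal.ofReal (w x) • Measure.dirac x

lemma integrable_discreteMeasure (s : Finset (Vec q)) (w f : Vec q → ℝ) :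
    Integrable f (discreteMeasure s w) := by
  rw [discreteMeasure, integrable_finsetSum_measure]
  exact fun x _ => (integrable_dirac (by simp)).smul_measure ENNReal.ofReal_ne_top

lemma integral_discreteMeasure (s : Finset (Vec q)) {w : Vec q → ℝ} (hw : ∀ x, 0 ≤ w x)
    (f : Vec q → ℝ) : ∫ x, f x ∂discreteMeasure s w = ∑ x ∈ s, w x * f x := by
  rw [discreteMeasure, integral_finsetSum_measure
    fun x _ => (integrable_dirac (by simp)).smul_measure ENNReal.ofReal_ne_top]
  simp [integral_smul_measure, integral_dirac, hw]

lemma discreteMeasure_univ (s : Finset (Vec q)) {w : Vec q → ℝ} (hw : ∀ x, 0 ≤ w x) :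
    discreteMeasure s w Set.univ = ENNReal.ofReal (∑ x ∈ s, w x) := by
  simp [discreteMeasure, ENNReal.ofReal_sum_of_nonneg fun x _ => hw x]

/-- Strong negative type, for finitely supported signed laws of mass zero: apply the definition to
the normalized positive and negative parts. -/
lemma IsStrongNegativeType.kernelForm_neg {ρ : Vec q → Vec q → ℝ} (hsymm : ∀ x y, ρ x y = ρ y x)
    (hρ : IsStrongNegativeType ρ) {σ : SignedLaw q} (hσ : mass σ = 0) (hne : σ ≠ 0) :
    kernelForm ρ σ σ < 0 := by
  set s := σ.support with hs
  have hsum : ∑ x ∈ s, σ x = 0 := by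
    simpa [mass, Finsupp.linearCombination_apply, Finsupp.sum] using hσ
  set m : ℝ := ∑ x ∈ s, max (σ x) 0 with hm
  have hm' : ∑ x ∈ s, max (-σ x) 0 = m := by
    have h : ∑ x ∈ s, max (σ x) 0 - ∑ x ∈ s, max (-σ x) 0 = ∑ x ∈ s, σ x := by
      rw [← Finset.sum_sub_distrib]
      refine Finset.sum_congr rfl fun x _ => ?_
      rcases le_total (σ x) 0 with h | h <;> simp [h]
    linarith
  have hmpos : 0 < m := by
    refine lt_of_le_of_ne (Finset.sum_nonneg fun x _ => le_max_right _ _) fun h0 => hne ?_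
    have h1 := (Finset.sum_eq_zero_iff_of_nonneg fun x _ => le_max_right (σ x) 0).1 (hm ▸ h0.symm)
    have h2 := (Finset.sum_eq_zero_iff_of_nonneg fun x _ => le_max_right (-σ x) 0).1
      (hm'.trans h0.symm)
    ext x
    by_cases hx : x ∈ s
    · have := le_max_left (σ x) 0
      have := le_max_left (-σ x) 0
      have := h1 x hx
      have := h2 x hx
      simp only [Finsupp.coe_zero, Pi.zero_apply]
      linarith
    · simpa [hs] using hx
  set p : Vec q → ℝ := fun x => max (σ x) 0 / m with hp
  set n : Vec q → ℝ := fun x => max (-σ x) 0 / m with hn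
  have hp0 : ∀ x, 0 ≤ p x := fun x => div_nonneg (le_max_right _ _) hmpos.le
  have hn0 : ∀ x, 0 ≤ n x := fun x => div_nonneg (le_max_right _ _) hmpos.le
  have hpn : ∀ x, σ x = m * (p x - n x) := fun x => by
    simp only [hp, hn]
    field_simp
    rcases le_total (σ x) 0 with h | h <;> simp [h]
  have hP : IsProbabilityMeasure (discreteMeasure s p) :=
    ⟨by rw [discreteMeasure_univ s hp0, ← Finset.sum_div, ← hm, div_self hmpos.ne',
      ENNReal.ofReal_one]⟩
  have hN : IsProbabilityMeasure (discreteMeasure s n) :=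
    ⟨by rw [discreteMeasure_univ s hn0, ← Finset.sum_div, hm', div_self hmpos.ne',
      ENNReal.ofReal_one]⟩
  have hneq : discreteMeasure s p ≠ discreteMeasure s n := fun h => hne <| by
    -- integrate the function `σ` itself
    have h1 : ∫ x, σ x ∂discreteMeasure s p = ∫ x, σ x ∂discreteMeasure s n := by rw [h]
    rw [integral_discreteMeasure s hp0, integral_discreteMeasure s hn0, ← sub_eq_zero,
      ← Finset.sum_sub_distrib] at h1
    have h2 : ∑ x ∈ s, σ x ^ 2 = 0 := by
      rw [← mul_zero m, ← h1, Finset.mul_sum]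
      refine Finset.sum_congr rfl fun x _ => ?_
      linear_combination σ x * hpn x
    rw [Finset.sum_eq_zero_iff_of_nonneg fun x _ => sq_nonneg _] at h2
    ext x
    by_cases hx : x ∈ s
    · simpa using h2 x hx
    · simpa [hs] using hx
  have key := hρ.strong _ _ hP hN ⟨0, integrable_discreteMeasure _ _ _⟩
    ⟨0, integrable_discreteMeasure _ _ _⟩ hneq
  simp only [integral_discreteMeasure s hp0, integral_discreteMeasure s hn0, Finset.mul_sum] at key
  have hpn' : ∑ x ∈ s, ∑ y ∈ s, n x * (p y * ρ x y) = ∑ x ∈ s, ∑ y ∈ s, p x * (n y * ρ x y) := by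
    rw [Finset.sum_comm]
    refine Finset.sum_congr rfl fun x _ => Finset.sum_congr rfl fun y _ => ?_
    rw [hsymm y x]
    ring
  have : kernelForm ρ σ σ = m ^ 2 * ((∑ x ∈ s, ∑ y ∈ s, p x * (p y * ρ x y))
      + (∑ x ∈ s, ∑ y ∈ s, n x * (n y * ρ x y))
      - ∑ x ∈ s, ∑ y ∈ s, 2 * (p x * (n y * ρ x y))) := by
    rw [kernelForm_apply]
    simp only [Finsupp.sum, ← hs]
    have h2 : ∑ x ∈ s, ∑ y ∈ s, 2 * (p x * (n y * ρ x y)) =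
        ∑ x ∈ s, ∑ y ∈ s, (p x * (n y * ρ x y) + n x * (p y * ρ x y)) := by
      simp only [two_mul, Finset.sum_add_distrib, hpn']
    rw [h2]
    simp only [← Finset.sum_add_distrib, ← Finset.sum_sub_distrib, Finset.mul_sum]
    refine Finset.sum_congr rfl fun x _ => Finset.sum_congr rfl fun y _ => ?_
    rw [hpn x, hpn y]
    ring
  rw [this]
  exact mul_neg_of_pos_of_neg (by positivity) key

/-- What the argument uses of the kernel: it is symmetric, positive definite and translation
invariant on signed laws of mass zero, and it vanishes at a base point. -/
structure IsMassZeroKernel (κ : Vec q → Vec q → ℝ) : Prop where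
  symm : ∀ μ ν, kernelForm κ μ ν = kernelForm κ ν μ
  pos : ∀ σ : SignedLaw q, mass σ = 0 → σ ≠ 0 → 0 < kernelForm κ σ σ
  shift_eq : ∀ (r : Vec q) (σ : SignedLaw q), mass σ = 0 →
    kernelForm κ (shift r σ) (shift r σ) = kernelForm κ σ σ
  base : ∃ z₀, ∀ σ, kernelForm κ (dirac z₀) σ = 0

lemma isMassZeroKernel_inducedKernel {ρ : Vec q → Vec q → ℝ} (hsm : IsSemimetric ρ)
    (hneg : IsStrongNegativeType ρ) (hshift : IsShiftInvariant ρ) (z₀ : Vec q) :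
    IsMassZeroKernel (inducedKernel ρ z₀) where
  symm := kernelForm_comm fun x y => by simp only [inducedKernel, hsm.symm x y]; ring
  pos σ hσ hne := by
    have := hneg.kernelForm_neg hsm.symm hσ hne
    rw [kernelForm_inducedKernel, hσ]
    linarith
  shift_eq r σ hσ := by
    rw [kernelForm_inducedKernel, kernelForm_inducedKernel, mass_shift, hσ,
      kernelForm_shift hshift]
    simp
  base := ⟨z₀, fun σ => by
    have h0 : ∀ x, inducedKernel ρ z₀ z₀ x = 0 := fun x => by
      simp [inducedKernel, (hsm.eq_zero_iff z₀ z₀).2 rfl, hsm.symm z₀ x]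
    simp [kernelForm_apply, dirac, h0]⟩

lemma IsMassZeroKernel.nonneg {κ : Vec q → Vec q → ℝ} (hκ : IsMassZeroKernel κ)
    {σ : SignedLaw q} (hσ : mass σ = 0) : 0 ≤ kernelForm κ σ σ := by
  by_cases h : σ = 0
  · simp [h]
  · exact (hκ.pos σ hσ h).le

end Kernel

/-! ### The MMD projection -/

section Projection

variable {q d : ℕ} {κ : Vec q → Vec q → ℝ} {θ : Fin d → Vec q}

lemma categorical_eq_linearCombination (θ : Fin d → Vec q) (p : Fin d → ℝ) :
    categorical θ p = Fintype.linearCombination ℝ (fun i => dirac (θ i)) p := rfl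

lemma mass_categorical (θ : Fin d → Vec q) (p : Fin d → ℝ) :
    mass (categorical θ p) = ∑ i, p i := by
  simp [categorical]

lemma mass_of_mem_signedCategorical {ν : SignedLaw q} (hν : ν ∈ signedCategorical θ) :
    mass ν = 1 := by
  obtain ⟨p, hp, rfl⟩ := hν
  rw [mass_categorical, hp]

/-- The laws of mass zero supported on the points `θ i`: the direction of the affine space of
mass-`1` signed categorical laws. -/
def categoricalDirection (θ : Fin d → Vec q) : Submodule ℝ (SignedLaw q) :=
  LinearMap.range (Fintype.linearCombination ℝ fun i => dirac (θ i)) ⊓ LinearMap.ker mass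

instance (θ : Fin d → Vec q) : FiniteDimensional ℝ (categoricalDirection θ) :=
  Submodule.finiteDimensional_of_le inf_le_left

lemma sub_mem_categoricalDirection {μ ν : SignedLaw q} (hμ : μ ∈ signedCategorical θ)
    (hν : ν ∈ signedCategorical θ) : μ - ν ∈ categoricalDirection θ := by
  refine ⟨?_, ?_⟩
  · obtain ⟨p, -, rfl⟩ := hμ
    obtain ⟨p', -, rfl⟩ := hν
    exact ⟨p - p', by rw [map_sub]; rfl⟩
  · change mass (μ - ν) = 0
    rw [map_sub, mass_of_mem_signedCategorical hμ,
      mass_of_mem_signedCategorical hν, sub_self]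

lemma add_mem_signedCategorical {ν δ : SignedLaw q} (hν : ν ∈ signedCategorical θ)
    (hδ : δ ∈ categoricalDirection θ) : ν + δ ∈ signedCategorical θ := by
  obtain ⟨p, hp, rfl⟩ := hν
  obtain ⟨⟨p', rfl⟩, h0⟩ := hδ
  refine ⟨p + p', ?_, ?_⟩
  · have h0' : mass (categorical θ p') = 0 := h0
    rw [mass_categorical] at h0'
    simp [Finset.sum_add_distrib, hp, h0']
  · simp only [categorical_eq_linearCombination, map_add]

lemma dirac_mem_signedCategorical (i : Fin d) : dirac (θ i) ∈ signedCategorical θ :=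
  ⟨Pi.single i 1, by simp, by simp [categorical, Pi.single_apply]⟩

lemma affine_mem_signedCategorical {μ ν : SignedLaw q} (hμ : μ ∈ signedCategorical θ)
    (hν : ν ∈ signedCategorical θ) (a : ℝ) : μ + a • (ν - μ) ∈ signedCategorical θ :=
  add_mem_signedCategorical hμ (Submodule.smul_mem _ _ (sub_mem_categoricalDirection hν hμ))

/-- Orthogonal projection onto a finite-dimensional space of mass-zero laws. -/
lemma IsMassZeroKernel.exists_orthogonalProjection (hκ : IsMassZeroKernel κ)
    (D : Submodule ℝ (SignedLaw q)) [FiniteDimensional ℝ D] (hD : D ≤ LinearMap.ker mass) :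
    ∃ P : SignedLaw q →ₗ[ℝ] SignedLaw q,
      ∀ σ, P σ ∈ D ∧ ∀ δ ∈ D, kernelForm κ (σ - P σ) δ = 0 := by
  let B : LinearMap.BilinForm ℝ D := (kernelForm κ).domRestrict₁₂ D D
  have hB : B.Nondegenerate := by
    have h : ∀ x : D, B x x = 0 → x = 0 := fun x hx => by
      by_contra hne
      exact (hκ.pos x (hD x.2) (by simpa using hne)).ne' hx
    exact ⟨fun x hx => h x (hx x), fun x hx => h x (hx x)⟩
  let L : SignedLaw q →ₗ[ℝ] Module.Dual ℝ D := (kernelForm κ).domRestrict₂ D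
  let T : Module.Dual ℝ D ≃ₗ[ℝ] D := (LinearMap.BilinForm.toDual (K := ℝ) (V := D) B hB).symm
  refine ⟨D.subtype ∘ₗ T.toLinearMap ∘ₗ L,
    fun σ => ⟨Subtype.coe_prop _, fun δ hδ => ?_⟩⟩
  have := LinearMap.BilinForm.apply_toDual_symm_apply (K := ℝ) (V := D) (B := B) (hB := hB)
    (L σ) ⟨δ, hδ⟩
  rw [map_sub, LinearMap.sub_apply, sub_eq_zero]
  exact this.symm

lemma IsMassZeroKernel.kernelForm_add_of_orthogonal (hκ : IsMassZeroKernel κ) {σ δ : SignedLaw q}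
    (h : kernelForm κ σ δ = 0) :
    kernelForm κ (σ + δ) (σ + δ) = kernelForm κ σ σ + kernelForm κ δ δ := by
  simp only [map_add, LinearMap.add_apply, hκ.symm δ σ, h]
  ring

/-- On laws of mass `1` the MMD projection is the restriction of an affine map, whose linear part
does not increase the MMD. -/
lemma IsMassZeroKernel.exists_proj_eq (hκ : IsMassZeroKernel κ) (hd : 1 ≤ d)
    (θ : Fin d → Vec q) :
    ∃ P : SignedLaw q →ₗ[ℝ] SignedLaw q, ∃ ν₀ ∈ signedCategorical θ,
      (∀ σ, P σ ∈ categoricalDirection θ) ∧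
      (∀ σ, mass σ = 0 → kernelForm κ (P σ) (P σ) ≤ kernelForm κ σ σ) ∧
      ∀ ν, mass ν = 1 → proj κ θ ν = ν₀ + P (ν - ν₀) := by
  obtain ⟨P, hP⟩ := hκ.exists_orthogonalProjection (categoricalDirection θ) inf_le_right
  have hν₀ := dirac_mem_signedCategorical (θ := θ) ⟨0, hd⟩
  set ν₀ := dirac (θ ⟨0, hd⟩)
  have hmassP : ∀ σ, mass (P σ) = 0 := fun σ => (hP σ).1.2
  refine ⟨P, ν₀, hν₀, fun σ => (hP σ).1, fun σ hσ => ?_, fun ν hν => ?_⟩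
  · have h := hκ.kernelForm_add_of_orthogonal ((hP σ).2 _ (hP σ).1)
    have h0 : 0 ≤ kernelForm κ (σ - P σ) (σ - P σ) :=
      hκ.nonneg (by rw [map_sub, hσ, hmassP, sub_self])
    rw [sub_add_cancel] at h
    linarith
  set c := ν₀ + P (ν - ν₀) with hc
  have hcF : c ∈ signedCategorical θ := add_mem_signedCategorical hν₀ (hP _).1
  -- Pythagoras: `c - ν` is orthogonal to the direction of the affine space
  have hpyth : ∀ μ ∈ signedCategorical θ, kernelForm κ (μ - ν) (μ - ν) =
      kernelForm κ (c - ν) (c - ν) + kernelForm κ (μ - c) (μ - c) := fun μ hμ => by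
    rw [← hκ.kernelForm_add_of_orthogonal, show c - ν + (μ - c) = μ - ν by abel]
    have h := (hP (ν - ν₀)).2 _ (sub_mem_categoricalDirection hμ hcF)
    rw [show c - ν = -(ν - ν₀ - P (ν - ν₀)) by rw [hc]; abel, map_neg, LinearMap.neg_apply, h,
      neg_zero]
  have hmass : ∀ μ ∈ signedCategorical θ, mass (μ - c) = 0 := fun μ hμ =>
    (sub_mem_categoricalDirection hμ hcF).2
  have hproj : IsProjection κ θ ν c := ⟨hcF, fun μ hμ => by
    rw [mmd_eq_sqrt, mmd_eq_sqrt, hpyth μ hμ]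
    exact Real.sqrt_le_sqrt (le_add_of_nonneg_right (hκ.nonneg (hmass μ hμ)))⟩
  have hspec : IsProjection κ θ ν (proj κ θ ν) := Classical.epsilon_spec ⟨c, hproj⟩
  have hle := hspec.2 c hcF
  rw [mmd_eq_sqrt, mmd_eq_sqrt, hpyth _ hspec.1] at hle
  have hcν : 0 ≤ kernelForm κ (c - ν) (c - ν) := hκ.nonneg (by
    rw [map_sub, hν, mass_of_mem_signedCategorical hcF, sub_self])
  rw [Real.sqrt_le_sqrt_iff hcν] at hle
  by_contra hne
  linarith [hκ.pos _ (hmass _ hspec.1) (sub_ne_zero.2 hne)]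

lemma IsMassZeroKernel.proj_mem (hκ : IsMassZeroKernel κ) (hd : 1 ≤ d) {ν : SignedLaw q}
    (hν : mass ν = 1) : proj κ θ ν ∈ signedCategorical θ := by
  obtain ⟨P, ν₀, h₀, hD, -, h⟩ := hκ.exists_proj_eq hd θ
  rw [h ν hν]
  exact add_mem_signedCategorical h₀ (hD _)

lemma IsMassZeroKernel.mmd_proj_le (hκ : IsMassZeroKernel κ) (hd : 1 ≤ d) {μ ν : SignedLaw q}
    (hμ : mass μ = 1) (hν : mass ν = 1) : mmd κ (proj κ θ μ) (proj κ θ ν) ≤ mmd κ μ ν := by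
  obtain ⟨P, ν₀, -, -, hle, h⟩ := hκ.exists_proj_eq hd θ
  rw [h μ hμ, h ν hν, mmd_eq_sqrt, mmd_eq_sqrt, add_sub_add_left_eq_sub, ← map_sub,
    sub_sub_sub_cancel_right]
  exact Real.sqrt_le_sqrt (hle _ (by rw [map_sub, hμ, hν, sub_self]))

lemma IsMassZeroKernel.proj_sum (hκ : IsMassZeroKernel κ) (hd : 1 ≤ d) {ι : Type*} [Fintype ι]
    (w : ι → ℝ) (hw : ∑ j, w j = 1) (ν : ι → SignedLaw q) (hν : ∀ j, mass (ν j) = 1) :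
    proj κ θ (∑ j, w j • ν j) = ∑ j, w j • proj κ θ (ν j) := by
  obtain ⟨P, ν₀, -, -, -, h⟩ := hκ.exists_proj_eq hd θ
  rw [h _ (by simp [hν, hw])]
  simp_rw [fun j => h (ν j) (hν j)]
  have h0 : ν₀ = ∑ j, w j • ν₀ := by rw [← Finset.sum_smul, hw, one_smul]
  conv_lhs => rw [h0]
  rw [← Finset.sum_sub_distrib, map_sum, ← Finset.sum_add_distrib]
  simp only [smul_add, ← smul_sub, map_smul]

lemma IsMassZeroKernel.mmd_shift (hκ : IsMassZeroKernel κ) (r : Vec q) {μ ν : SignedLaw q}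
    (hμ : mass μ = 1) (hν : mass ν = 1) : mmd κ (shift r μ) (shift r ν) = mmd κ μ ν := by
  rw [mmd_eq_sqrt, mmd_eq_sqrt, ← shift_sub, hκ.shift_eq r _ (by rw [map_sub, hμ, hν, sub_self])]

/-! ### The Gram-matrix embedding is an isometry -/

lemma kernelForm_categorical (κ : Vec q → Vec q → ℝ) (θ : Fin d → Vec q) (p p' : Fin d → ℝ) :
    kernelForm κ (categorical θ p) (categorical θ p') =
      p ⬝ᵥ Matrix.mulVec (gram κ θ) p' := by
  simp only [categorical, map_sum, LinearMap.sum_apply, map_smul, LinearMap.smul_apply, dirac,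
    kernelForm_single_single, dotProduct, Matrix.mulVec, gram, Matrix.of_apply, smul_eq_mul,
    Finset.mul_sum, one_mul]
  rw [Finset.sum_comm]
  exact Finset.sum_congr rfl fun i _ => Finset.sum_congr rfl fun j _ => by ring

/-- The Gram matrix is positive semidefinite: as the kernel vanishes at its base point `z₀`, a mass
at `z₀` turns any law into one of mass zero at no cost. -/
lemma IsMassZeroKernel.gram_posSemidef (hκ : IsMassZeroKernel κ) (θ : Fin d → Vec q) :
    (gram κ θ).PosSemidef := by
  refine Matrix.PosSemidef.of_dotProduct_mulVec_nonneg ?_ fun p => ?_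
  · ext i j
    have := hκ.symm (dirac (θ j)) (dirac (θ i))
    simpa [dirac, gram] using this
  · obtain ⟨z₀, hz₀⟩ := hκ.base
    have h := hκ.nonneg (σ := categorical θ p - (∑ i, p i) • dirac z₀) (by
      rw [map_sub, mass_categorical, map_smul, mass_dirac]; simp)
    simp only [map_sub, LinearMap.sub_apply, map_smul, LinearMap.smul_apply, hz₀,
      hκ.symm _ (dirac z₀)] at h
    simpa [kernelForm_categorical] using h

open scoped MatrixOrder in
lemma IsMassZeroKernel.gramSqrt_mul_self (hκ : IsMassZeroKernel κ) (θ : Fin d → Vec q) :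
    (gramSqrt κ θ).conjTranspose * gramSqrt κ θ = gram κ θ := by
  have h0 : 0 ≤ gram κ θ := Matrix.nonneg_iff_posSemidef.2 (hκ.gram_posSemidef θ)
  have h1 : (gramSqrt κ θ).PosSemidef := Matrix.nonneg_iff_posSemidef.1 (CFC.sqrt_nonneg _)
  rw [h1.isHermitian.eq]
  exact CFC.sqrt_mul_sqrt_self _ h0

lemma categorical_apply (hθ : Function.Injective θ) (p : Fin d → ℝ) (i : Fin d) :
    categorical θ p (θ i) = p i := by
  simp [categorical, dirac, Finsupp.finsetSum_apply, Finsupp.single_apply, hθ.eq_iff]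

/-- The embedding `embed` as a linear map. -/
def embedLinear (κ : Vec q → Vec q → ℝ) (θ : Fin d → Vec q) :
    SignedLaw q →ₗ[ℝ] EuclideanSpace ℝ (Fin d) where
  toFun := embed κ θ
  map_add' μ ν := by
    rw [embed, embed, embed, ← WithLp.toLp_add, ← Matrix.mulVec_add]
    rfl
  map_smul' c ν := by
    rw [embed, embed, RingHom.id_apply, ← WithLp.toLp_smul, ← Matrix.mulVec_smul]
    rfl

lemma embedLinear_apply (κ : Vec q → Vec q → ℝ) (θ : Fin d → Vec q) (ν : SignedLaw q) :
    embedLinear κ θ ν = embed κ θ ν := rfl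

lemma IsMassZeroKernel.norm_embed_sub (hκ : IsMassZeroKernel κ) (hθ : Function.Injective θ)
    {μ ν : SignedLaw q} (hμ : μ ∈ signedCategorical θ) (hν : ν ∈ signedCategorical θ) :
    ‖embed κ θ μ - embed κ θ ν‖ = mmd κ μ ν := by
  obtain ⟨⟨p, hp⟩, -⟩ := sub_mem_categoricalDirection hμ hν
  rw [← embedLinear_apply, ← embedLinear_apply, ← map_sub, embedLinear_apply, mmd_eq_sqrt, ← hp,
    ← categorical_eq_linearCombination, kernelForm_categorical, ← hκ.gramSqrt_mul_self θ,
    EuclideanSpace.norm_eq]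
  congr 1
  simp only [embed, categorical_apply hθ, Matrix.conjTranspose_eq_transpose_of_trivial]
  rw [← Matrix.mulVec_mulVec, Matrix.dotProduct_mulVec, Matrix.vecMul_transpose]
  simp [dotProduct, sq]

lemma IsMassZeroKernel.unembed_embed (hκ : IsMassZeroKernel κ) (hθ : Function.Injective θ)
    {ν : SignedLaw q} (hν : ν ∈ signedCategorical θ) : unembed κ θ (embed κ θ ν) = ν := by
  refine Set.InjOn.leftInvOn_invFunOn (fun μ hμ μ' hμ' h => ?_) hν
  have h0 := hκ.norm_embed_sub hθ hμ hμ'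
  rw [h, sub_self, norm_zero, mmd_eq_sqrt, eq_comm] at h0
  have hm := (sub_mem_categoricalDirection hμ hμ').2
  rw [Real.sqrt_eq_zero (hκ.nonneg hm)] at h0
  by_contra hne
  exact (hκ.pos _ hm (sub_ne_zero.2 hne)).ne' h0

end Projection

/-! ### The Markov property of an episode -/

section Markov

variable {S A : Type*} {H : ℕ}

/-- The weight of an episode for the initial weights `ν` and the transition weights `w`. -/
def pathWeight (w : S → A → S → ℝ) (ν : S → ℝ) (e : Episode H S A) : ℝ :=
  ν (e.1 0) * ∏ t : Fin H, w (e.1 t.castSucc) (e.2 t) (e.1 t.succ)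

/-- An episode, extended by the action `a` and the state `s`. -/
def Episode.snoc (e : Episode H S A) (a : A) (s : S) : Episode (H + 1) S A :=
  (Fin.snoc (α := fun _ => S) e.1 s, Fin.snoc (α := fun _ => A) e.2 a)

lemma pathWeight_snoc (w : S → A → S → ℝ) (ν : S → ℝ) (e : Episode H S A) (a : A) (s : S) :
    pathWeight w ν (e.snoc a s) = pathWeight w ν e * w (e.1 (Fin.last H)) a s := by
  simp only [pathWeight, Episode.snoc, Fin.prod_univ_castSucc, Fin.snoc_castSucc,
    Fin.succ_castSucc, Fin.snoc_last, Fin.succ_last, ← Fin.castSucc_zero]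
  ring

variable [Fintype S] [Fintype A]

lemma sum_episode_succ (f : Episode (H + 1) S A → ℝ) :
    ∑ e, f e = ∑ e : Episode H S A, ∑ a, ∑ s, f (e.snoc a s) := by
  simp only [Fintype.sum_prod_type, Episode.snoc]
  rw [← (Fin.snocEquiv fun _ : Fin (H + 1 + 1) => S).sum_comp, Fintype.sum_prod_type,
    Finset.sum_comm]
  refine Finset.sum_congr rfl fun e _ => ?_
  simp_rw [← (Fin.snocEquiv fun _ : Fin (H + 1) => A).sum_comp, Fintype.sum_prod_type]
  simp_rw [Finset.sum_comm (s := (Finset.univ : Finset A)) (t := (Finset.univ : Finset (Fin H → A)))]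
  rw [Finset.sum_comm]
  refine Finset.sum_congr rfl fun b _ => ?_
  rw [Finset.sum_comm]
  rfl

lemma sum_pathWeight {w : S → A → S → ℝ} (hw : ∀ s, ∑ a, ∑ s', w s a s' = 1) {ν : S → ℝ}
    (hν : ∑ s, ν s = 1) : ∑ e : Episode H S A, pathWeight w ν e = 1 := by
  induction H with
  | zero =>
    rw [← hν, Fintype.sum_prod_type]
    simp only [pathWeight, Finset.univ_eq_empty, Finset.prod_empty, mul_one, Finset.sum_const,
      Finset.card_univ, Fintype.card_unique, one_smul]
    exact (Equiv.funUnique (Fin 1) S).sum_comp ν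
  | succ H ih =>
    rw [sum_episode_succ]
    simp only [pathWeight_snoc, ← Finset.mul_sum, hw, mul_one, ih]

open Classical in
/-- The Markov property: given the state at phase `t`, the transition at phase `t` is drawn from the
transition weights. -/
lemma sum_pathWeight_transition {w : S → A → S → ℝ} (hw : ∀ s, ∑ a, ∑ s', w s a s' = 1) (ν : S → ℝ)
    (t : Fin H) (x : S) (f : A → S → ℝ) :
    ∑ e : Episode H S A,
        pathWeight w ν e * (if e.1 t.castSucc = x then f (e.2 t) (e.1 t.succ) else 0) =
      (∑ e : Episode H S A, if e.1 t.castSucc = x then pathWeight w ν e else 0) *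
        ∑ a, ∑ s', w x a s' * f a s' := by
  induction H with
  | zero => exact t.elim0
  | succ H ih =>
    simp only [sum_episode_succ, pathWeight_snoc]
    induction t using Fin.lastCases with
    | last =>
      simp only [Episode.snoc, Fin.snoc_castSucc, Fin.snoc_last, Fin.succ_last]
      rw [Finset.sum_mul]
      refine Finset.sum_congr rfl fun e _ => ?_
      by_cases h : e.1 (Fin.last H) = x
      · simp only [h, if_true, ← Finset.mul_sum, hw, mul_one, mul_assoc]
      · simp [h]
    | cast t =>
      simp only [Episode.snoc, Fin.snoc_castSucc, Fin.succ_castSucc]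
      have := ih t
      convert this using 1
      · refine Finset.sum_congr rfl fun e _ => ?_
        simp only [mul_right_comm _ (w _ _ _), ← Finset.mul_sum, hw, mul_one]
      · congr 1
        refine Finset.sum_congr rfl fun e _ => ?_
        split_ifs
        · simp only [← Finset.mul_sum, hw, mul_one]
        · simp

end Markov

/-! ### Scalar recursions -/

section Scalar

/-- Comparison of a scalar recursion with a solution `Q` of the homogeneous inequality and a
supersolution `D` of the inhomogeneous one. -/
lemma le_of_recursion {x r b Q D : ℕ → ℝ} (hx : ∀ m, x (m + 1) ≤ (1 - r m) * x m + b m)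
    (hr : ∀ m, r m ≤ 1) (hx0 : 0 ≤ x 0) (hQ0 : Q 0 = 1) (hD0 : 0 ≤ D 0)
    (hQ : ∀ m, (1 - r m) * Q m ≤ Q (m + 1))
    (hD : ∀ m, (1 - r m) * D m + b m ≤ D (m + 1)) (m : ℕ) : x m ≤ x 0 * Q m + D m := by
  induction m with
  | zero => rw [hQ0]; linarith
  | succ m ih =>
    have h1 := mul_le_mul_of_nonneg_left ih (sub_nonneg.2 (hr m))
    have h2 := mul_le_mul_of_nonneg_left (hQ m) hx0
    linarith [hx m, hD m]

variable {H : ℕ}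

lemma tau_succ (g : ℝ) (m : ℕ) : tau H g (m + 1) = tau H g m + H := by
  simp only [tau]; push_cast; ring

lemma le_tau (hH : 1 ≤ H) (g : ℝ) (m : ℕ) : g ≤ tau H g m := by
  have : (1 : ℝ) ≤ H := by exact_mod_cast hH
  have : (0 : ℝ) ≤ m * H := by positivity
  simp only [tau]; linarith

/-- The total step size of episode `m`, bounded above and below in terms of the last clock `τ_m` of
the episode. -/
lemma stepSum_bounds (hH : 1 ≤ H) {α g z : ℝ} (hα : 0 < α) (hg : 1 ≤ g) (hz0 : 0 ≤ z)
    (hz1 : z ≤ 1) (m : ℕ) :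
    H * (α / tau H g m ^ z) ≤ ∑ t ∈ Finset.range H, α / (((m * H + t : ℕ) : ℝ) + g) ^ z ∧
      ∑ t ∈ Finset.range H, α / (((m * H + t : ℕ) : ℝ) + g) ^ z ≤
        H ^ 2 * (α / tau H g m ^ z) := by
  have hH' : (1 : ℝ) ≤ H := by exact_mod_cast hH
  have hτ : 1 ≤ tau H g m := hg.trans (le_tau hH g m)
  constructor
  · have : ∀ t ∈ Finset.range H,
        α / tau H g m ^ z ≤ α / (((m * H + t : ℕ) : ℝ) + g) ^ z := fun t ht => by
      have ht' : (t : ℝ) + 1 ≤ H := by exact_mod_cast Finset.mem_range.1 ht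
      have h0 : (0 : ℝ) < ((m * H + t : ℕ) : ℝ) + g := by positivity
      refine div_le_div_of_nonneg_left hα.le (Real.rpow_pos_of_pos h0 z)
        (Real.rpow_le_rpow h0.le ?_ hz0)
      simp only [tau]; push_cast; linarith
    simpa using Finset.card_nsmul_le_sum _ _ _ this
  · have : ∀ t ∈ Finset.range H,
        α / (((m * H + t : ℕ) : ℝ) + g) ^ z ≤ H * (α / tau H g m ^ z) := fun t _ => by
      have ht : (0 : ℝ) ≤ t := t.cast_nonneg
      have hm : (0 : ℝ) ≤ m * H := by positivity
      have h0 : (0 : ℝ) < ((m * H + t : ℕ) : ℝ) + g := by positivity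
      -- as `m H + g ≥ 1`, the clocks of one episode differ by a factor of at most `H`
      have h1 : tau H g m ≤ H * (((m * H + t : ℕ) : ℝ) + g) := by
        simp only [tau]; push_cast
        nlinarith [mul_nonneg (sub_nonneg.2 hH') (show (0 : ℝ) ≤ m * H + t + g - 1 by linarith)]
      have h2 : tau H g m ^ z ≤ H * (((m * H + t : ℕ) : ℝ) + g) ^ z := by
        calc tau H g m ^ z ≤ (H * (((m * H + t : ℕ) : ℝ) + g)) ^ z :=
              Real.rpow_le_rpow (by linarith) h1 hz0
          _ = (H : ℝ) ^ z * (((m * H + t : ℕ) : ℝ) + g) ^ z :=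
              Real.mul_rpow (by linarith) h0.le
          _ ≤ _ := by
              gcongr
              simpa using Real.rpow_le_rpow_of_exponent_le hH' hz1
      have h3 : 0 < tau H g m ^ z := Real.rpow_pos_of_pos (by linarith) z
      have h4 : 0 < (((m * H + t : ℕ) : ℝ) + g) ^ z := Real.rpow_pos_of_pos h0 z
      rw [mul_div_assoc', div_le_div_iff₀ h4 h3]
      nlinarith
    refine (Finset.sum_le_card_nsmul _ _ _ this).trans (le_of_eq ?_)
    simp; ring

variable {x A : ℕ → ℝ} {c B : ℝ}

/-- The recursion of one episode, with its total step size `A m` replaced by bounds. -/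
lemma recursion_of_bounds (hx : ∀ m, x (m + 1) ≤ (1 - c * A m) * x m + B * A m ^ 2)
    (hx0 : ∀ m, 0 ≤ x m) (hc : 0 < c) (hB : 0 ≤ B) {y : ℝ} {m : ℕ} (hy : 0 ≤ y)
    (h1 : H * y ≤ A m) (h2 : A m ≤ H ^ 2 * y) :
    x (m + 1) ≤ (1 - c * (H * y)) * x m + B * H ^ 4 * y ^ 2 := by
  have h3 : 0 ≤ A m := le_trans (by positivity) h1
  have h4 : A m ^ 2 ≤ (H ^ 2 * y) ^ 2 := pow_le_pow_left₀ h3 h2 2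
  have h5 := mul_le_mul_of_nonneg_left h1 hc.le
  nlinarith [hx m, mul_le_mul_of_nonneg_right h5 (hx0 m), mul_le_mul_of_nonneg_left h4 hB]

lemma recursion_const (hx : ∀ m, x (m + 1) ≤ (1 - c * A m) * x m + B * A m ^ 2)
    (hx0 : 0 ≤ x 0) (hc : 0 < c) (hB : 0 ≤ B) (hH : 1 ≤ H) {α : ℝ} (hα : 0 < α)
    (hA : ∀ m, A m = H * α) (hcα : c * H * α ≤ 1) (m : ℕ) :
    x m ≤ x 0 * (1 - c * H * α) ^ m + B * H / c * α := by
  have hH' : (1 : ℝ) ≤ H := by exact_mod_cast hH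
  refine le_of_recursion (r := fun _ => c * H * α) (b := fun _ => B * (H * α) ^ 2)
    (Q := fun m => (1 - c * H * α) ^ m) (D := fun _ => B * H / c * α) (fun m => ?_)
    (fun _ => hcα) hx0 (pow_zero _) (by positivity) (fun m => by rw [pow_succ']) (fun m => ?_) m
  · have := hx m
    rwa [hA m, ← mul_assoc] at this
  · refine le_of_eq ?_
    field_simp
    ring

/-- Steps `α / (k + g)`: the supersolution is a multiple of `1 / τ_m`. -/
lemma recursion_linear (hx : ∀ m, x (m + 1) ≤ (1 - c * A m) * x m + B * A m ^ 2)
    (hx0 : ∀ m, 0 ≤ x m) (hc : 0 < c) (hB : 0 ≤ B) (hH : 1 ≤ H) {α g : ℝ} (hα : 1 / c < α)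
    (hg : 1 ≤ g) (hA : ∀ m, A m = ∑ t ∈ Finset.range H, α / (((m * H + t : ℕ) : ℝ) + g))
    (hcα : c * H * α ≤ g) (m : ℕ) :
    x m ≤ x 0 * (tau H g 0 / tau H g m) ^ (c * α)
      + B * H ^ 3 * (α ^ 2 / (c * α - 1) * (1 / tau H g m)) := by
  have hH' : (1 : ℝ) ≤ H := by exact_mod_cast hH
  have hτ : ∀ m, 1 ≤ tau H g m := fun m => hg.trans (le_tau hH g m)
  have hτ0 : ∀ m, 0 < tau H g m := fun m => zero_lt_one.trans_le (hτ m)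
  have hα0 : 0 < α := (by positivity : 0 < 1 / c).trans hα
  have hcα1 : 0 < c * α - 1 := by
    rw [div_lt_iff₀ hc] at hα; linarith
  refine le_of_recursion (r := fun m => c * (H * (α / tau H g m)))
    (b := fun m => B * H ^ 4 * (α / tau H g m) ^ 2)
    (Q := fun m => (tau H g 0 / tau H g m) ^ (c * α))
    (D := fun m => B * H ^ 3 * (α ^ 2 / (c * α - 1) * (1 / tau H g m)))
    (fun m => ?_) (fun m => ?_) (hx0 0) ?_ ?_ (fun m => ?_) (fun m => ?_) m
  · have h := stepSum_bounds hH hα0 hg zero_le_one le_rfl m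
    simp only [Real.rpow_one, ← hA m] at h
    exact recursion_of_bounds hx hx0 hc hB (div_nonneg hα0.le (hτ0 m).le) h.1 h.2
  · rw [← mul_assoc, ← mul_div_assoc, div_le_one (hτ0 m)]
    exact hcα.trans (le_tau hH g m)
  · rw [div_self (hτ0 0).ne', Real.one_rpow]
  · have := hτ0 0
    positivity
  · have h1 : (1 - c * (H * (α / tau H g m))) ≤ (tau H g m / tau H g (m + 1)) ^ (c * α) := by
      rw [Real.rpow_def_of_pos (div_pos (hτ0 _) (hτ0 _))]
      refine le_trans ?_ (Real.add_one_le_exp _)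
      -- `log (τ_m / τ_{m+1}) ≥ 1 - τ_{m+1} / τ_m = - H / τ_m`
      have h2 := Real.one_sub_inv_le_log_of_pos (div_pos (hτ0 m) (hτ0 (m + 1)))
      rw [inv_div, tau_succ, add_div, div_self (hτ0 m).ne'] at h2
      have h3 := mul_le_mul_of_nonneg_right h2 (mul_pos hc hα0).le
      rw [← tau_succ] at h3
      calc 1 - c * (H * (α / tau H g m))
          = (1 - (1 + H / tau H g m)) * (c * α) + 1 := by ring
        _ ≤ _ := by linarith
    calc _ ≤ (tau H g m / tau H g (m + 1)) ^ (c * α) * (tau H g 0 / tau H g m) ^ (c * α) :=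
          mul_le_mul_of_nonneg_right h1 (Real.rpow_nonneg (div_pos (hτ0 _) (hτ0 _)).le _)
      _ = _ := by
          rw [← Real.mul_rpow (div_pos (hτ0 _) (hτ0 _)).le (div_pos (hτ0 _) (hτ0 _)).le]
          congr 1
          have := (hτ0 m).ne'
          field_simp
  · have h1 := hτ0 m
    rw [tau_succ]
    set τ := tau H g m
    have h2 : 0 < τ + H := by linarith
    have h3 : 1 / τ - 1 / (τ + H) ≤ H / τ ^ 2 := by
      rw [div_sub_div _ _ h1.ne' h2.ne', div_le_div_iff₀ (by positivity) (by positivity)]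
      nlinarith [mul_nonneg (mul_nonneg h1.le (sq_nonneg (H : ℝ))) zero_le_one]
    have h4 : (1 - c * (H * (α / τ))) * (B * H ^ 3 * (α ^ 2 / (c * α - 1) * (1 / τ)))
        + B * H ^ 4 * (α / τ) ^ 2
        = B * H ^ 3 * (α ^ 2 / (c * α - 1) * (1 / τ - H / τ ^ 2)) := by
      field_simp
      ring
    rw [h4]
    gcongr
    linarith

/-- The tangent line bound for the concave function `x ↦ x ^ z`. -/
lemma rpow_add_le {τ h z : ℝ} (hτ : 0 < τ) (hh : 0 ≤ h) (hz0 : 0 ≤ z) (hz1 : z ≤ 1) :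
    (τ + h) ^ z ≤ τ ^ z + z * h * (τ ^ z / τ) := by
  have h1 := rpow_one_add_le_one_add_mul_self (s := h / τ) (p := z)
    (by have : 0 ≤ h / τ := by positivity
        linarith) hz0 hz1
  calc (τ + h) ^ z = τ ^ z * (1 + h / τ) ^ z := by
        rw [← Real.mul_rpow hτ.le (by positivity)]
        congr 1
        field_simp
    _ ≤ τ ^ z * (1 + z * (h / τ)) := by gcongr
    _ = _ := by ring

/-- Steps `α / (k + g) ^ z`: the supersolution is a multiple of `1 / τ_m ^ z`, whose decrease is at
most half the contraction by the lower bound `hg'` on the offset. -/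
lemma recursion_poly (hx : ∀ m, x (m + 1) ≤ (1 - c * A m) * x m + B * A m ^ 2)
    (hx0 : ∀ m, 0 ≤ x m) (hc : 0 < c) (hB : 0 ≤ B) (hH : 1 ≤ H) {α g z : ℝ} (hα : 0 < α)
    (hz0 : 0 < z) (hz1 : z < 1) (hg : 1 ≤ g)
    (hA : ∀ m, A m = ∑ t ∈ Finset.range H, α / (((m * H + t : ℕ) : ℝ) + g) ^ z)
    (hcα : c * H * α ≤ g ^ z) (hg' : 2 * z / (c * α) ≤ g ^ (1 - z)) (m : ℕ) :
    x m ≤ x 0 * Real.exp (-(c * α / (1 - z)) * (tau H g m ^ (1 - z) - tau H g 0 ^ (1 - z)))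
      + 2 * B * H ^ 3 / c * (α / tau H g m ^ z) := by
  have hH' : (1 : ℝ) ≤ H := by exact_mod_cast hH
  have hτ : ∀ m, 1 ≤ tau H g m := fun m => hg.trans (le_tau hH g m)
  have hτ0 : ∀ m, 0 < tau H g m := fun m => zero_lt_one.trans_le (hτ m)
  have hz1' : 0 < 1 - z := sub_pos.2 hz1
  have hτz : ∀ m, 0 < tau H g m ^ z := fun m => Real.rpow_pos_of_pos (hτ0 m) z
  refine le_of_recursion (r := fun m => c * (H * (α / tau H g m ^ z)))
    (b := fun m => B * H ^ 4 * (α / tau H g m ^ z) ^ 2)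
    (Q := fun m => Real.exp (-(c * α / (1 - z)) * (tau H g m ^ (1 - z) - tau H g 0 ^ (1 - z))))
    (D := fun m => 2 * B * H ^ 3 / c * (α / tau H g m ^ z))
    (fun m => ?_) (fun m => ?_) (hx0 0) ?_ ?_ (fun m => ?_) (fun m => ?_) m
  · have h := stepSum_bounds hH hα hg hz0.le hz1.le m
    rw [← hA m] at h
    exact recursion_of_bounds hx hx0 hc hB (div_nonneg hα.le (hτz m).le) h.1 h.2
  · rw [← mul_assoc, ← mul_div_assoc, div_le_one (hτz m)]
    exact hcα.trans (Real.rpow_le_rpow (by linarith) (le_tau hH g m) hz0.le)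
  · simp
  · have := hτz 0
    positivity
  · have h1 := rpow_add_le (hτ0 m) (h := H) (by linarith) hz1'.le (by linarith)
    have h0 : tau H g m ^ (1 - z) / tau H g m = 1 / tau H g m ^ z := by
      have := (hτ0 m).ne'
      rw [Real.rpow_sub (hτ0 m), Real.rpow_one]
      field_simp
    rw [← tau_succ, h0] at h1
    calc _ ≤ Real.exp (-(c * (H * (α / tau H g m ^ z))))
          * Real.exp (-(c * α / (1 - z)) * (tau H g m ^ (1 - z) - tau H g 0 ^ (1 - z))) := by
          gcongr
          exact Real.one_sub_le_exp_neg _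
      _ ≤ _ := by
          rw [← Real.exp_add, Real.exp_le_exp]
          have h2 := mul_le_mul_of_nonneg_left h1 (by positivity : 0 ≤ c * α / (1 - z))
          have h3 : c * α / (1 - z) * ((1 - z) * H * (1 / tau H g m ^ z)) =
            c * (H * (α / tau H g m ^ z)) := by field_simp
          rw [mul_add, h3] at h2
          linarith
  · have h1 := hτ0 m
    have h2 : g ^ (1 - z) ≤ tau H g m ^ (1 - z) :=
      Real.rpow_le_rpow (by linarith) (le_tau hH g m) hz1'.le
    have h3 := rpow_add_le h1 (h := H) (by linarith) hz0.le hz1.le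
    have h4 := hτz m
    rw [Real.rpow_sub h1, Real.rpow_one] at h2
    rw [← tau_succ] at h3
    have h5 := hτz (m + 1)
    have h6 := hτ0 (m + 1)
    set τ := tau H g m
    set y := τ ^ z
    set y' := tau H g (m + 1) ^ z
    have hyy : y ≤ y' := Real.rpow_le_rpow h1.le (by rw [tau_succ]; linarith) hz0.le
    -- `z / τ ≤ c α / (2 τ ^ z)` is the lower bound on the offset
    have h7 : z / τ ≤ c * α / (2 * y) := by
      have := hg'.trans h2
      rw [div_le_div_iff₀ (by positivity) h4] at this
      rw [div_le_div_iff₀ h1 (by positivity)]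
      linarith
    have h8 : 1 / y - 1 / y' ≤ c * α / 2 * H / y ^ 2 := by
      have h9 : y' - y ≤ H * y * (c * α / (2 * y)) := by
        have := mul_le_mul_of_nonneg_left h7 (by positivity : 0 ≤ H * y)
        calc y' - y ≤ z * H * (y / τ) := by linarith
          _ = H * y * (z / τ) := by ring
          _ ≤ _ := this
      have h10 : H * y * (c * α / (2 * y)) = c * α / 2 * H := by field_simp
      rw [h10] at h9
      rw [div_sub_div _ _ h4.ne' h5.ne', div_le_div_iff₀ (by positivity) (by positivity)]
      have : 0 ≤ c * α / 2 * H := by positivity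
      calc (1 * y' - y * 1) * y ^ 2 ≤ (c * α / 2 * H) * y ^ 2 := by
            gcongr; linarith
        _ ≤ c * α / 2 * H * (y * y') := by
            rw [sq]; gcongr
    have h11 : (1 - c * (H * (α / y))) * (2 * B * H ^ 3 / c * (α / y))
        + B * H ^ 4 * (α / y) ^ 2
        = 2 * B * H ^ 3 / c * α * (1 / y - c * α / 2 * H / y ^ 2) := by
      field_simp
      ring
    rw [h11, ← mul_one_div α y', ← mul_assoc]
    gcongr
    linarith

end Scalar

/-! ### One episode of an asynchronous recursion -/

section Core

variable {S A E : Type*} {H : ℕ} [NormedAddCommGroup E]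

open Classical in
/-- The direction of the update of the stack `U` for the transition `(s, a, s')` and the target map
`G`: only the blocks at the visited state `s` are moved. -/
def increment (G : (Fin H → S → E) → S → A → S → Fin H → E) (U : Fin H → S → E) (s : S) (a : A)
    (s' : S) : Fin H → S → E :=
  fun i x => if x = s then G U s a s' i - U i s else 0

/-- The norm of the layer below the horizon `i + 1` at the state `s`; the terminal layer is
exact. -/
def belowNorm (D : Fin H → S → E) (i : Fin H) (s : S) : ℝ :=
  if i.val = 0 then 0 else ‖D ⟨i.val - 1, lt_of_le_of_lt (Nat.sub_le _ _) i.isLt⟩ s‖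

/-- The weighted sum of squares `∑ i, δ ^ i ∑ x, ‖D i x‖ ^ 2`. For small `δ` the contraction of a
layer dominates its forcing by the layer below. -/
def lyapunov [Fintype S] (δ : ℝ) (D : Fin H → S → E) : ℝ :=
  ∑ i, δ ^ i.val * ∑ x, ‖D i x‖ ^ 2

variable [Fintype S]

lemma norm_block_le (D : Fin H → S → E) (i : Fin H) (s : S) : ‖D i s‖ ≤ ‖D‖ :=
  (norm_le_pi_norm (D i) s).trans (norm_le_pi_norm D i)

lemma norm_stack_le {D : Fin H → S → E} {r : ℝ} (hr : 0 ≤ r) (h : ∀ i s, ‖D i s‖ ≤ r) :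
    ‖D‖ ≤ r :=
  (pi_norm_le_iff_of_nonneg hr).2 fun i => (pi_norm_le_iff_of_nonneg hr).2 (h i)

lemma belowNorm_le (D : Fin H → S → E) (i : Fin H) (s : S) : belowNorm D i s ≤ ‖D‖ := by
  rw [belowNorm]
  split_ifs
  · exact norm_nonneg _
  · exact norm_block_le _ _ _

lemma lyapunov_nonneg {δ : ℝ} (hδ : 0 ≤ δ) (D : Fin H → S → E) : 0 ≤ lyapunov δ D := by
  unfold lyapunov; positivity

lemma lyapunov_le {δ : ℝ} (hδ : 0 ≤ δ) (hδ1 : δ ≤ 1) {D : Fin H → S → E} {r : ℝ}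
    (h : ∀ i s, ‖D i s‖ ^ 2 ≤ r) : lyapunov δ D ≤ H * Fintype.card S * r := by
  have : ∀ i ∈ (Finset.univ : Finset (Fin H)),
      δ ^ i.val * ∑ x, ‖D i x‖ ^ 2 ≤ Fintype.card S * r := fun i _ => by
    have h1 : ∑ x, ‖D i x‖ ^ 2 ≤ Fintype.card S * r := by
      simpa using Finset.sum_le_card_nsmul Finset.univ _ _ fun x _ => h i x
    calc _ ≤ 1 * (Fintype.card S * r) := by
          gcongr
          exact pow_le_one₀ hδ hδ1
      _ = _ := one_mul _
  simpa [lyapunov, mul_assoc] using Finset.sum_le_card_nsmul _ _ _ this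

lemma norm_sq_le_lyapunov {δ : ℝ} (hδ : 0 < δ) (hδ1 : δ ≤ 1) (D : Fin H → S → E) :
    ‖D‖ ^ 2 ≤ lyapunov δ D / δ ^ H := by
  have h : ∀ i s, ‖D i s‖ ≤ √(lyapunov δ D / δ ^ H) := fun i s => by
    refine Real.le_sqrt_of_sq_le ?_
    rw [le_div_iff₀ (by positivity)]
    calc ‖D i s‖ ^ 2 * δ ^ H ≤ ‖D i s‖ ^ 2 * δ ^ i.val := by
          gcongr ‖D i s‖ ^ 2 * ?_
          exact pow_le_pow_of_le_one hδ.le hδ1 i.isLt.le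
      _ ≤ δ ^ i.val * ∑ x, ‖D i x‖ ^ 2 := by
          rw [mul_comm]
          gcongr
          exact Finset.single_le_sum (f := fun x => ‖D i x‖ ^ 2) (fun _ _ => sq_nonneg _)
            (Finset.mem_univ s)
      _ ≤ _ := Finset.single_le_sum (f := fun i : Fin H => δ ^ i.val * ∑ x, ‖D i x‖ ^ 2)
            (fun _ _ => by positivity) (Finset.mem_univ i)
  have h0 := lyapunov_nonneg hδ.le D
  have := pow_le_pow_left₀ (norm_nonneg _) (norm_stack_le (Real.sqrt_nonneg _) h) 2
  rwa [Real.sq_sqrt (by positivity)] at this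

/-- The forcing of each layer by the layer below it costs a factor `δ`. -/
lemma sum_belowNorm_sq_le {δ : ℝ} (hδ : 0 ≤ δ) (D : Fin H → S → E) :
    ∑ i, δ ^ i.val * ∑ s, belowNorm D i s ^ 2 ≤ δ * lyapunov δ D := by
  cases H with
  | zero => simp [lyapunov]
  | succ n =>
    rw [lyapunov, Fin.sum_univ_succ, Fin.sum_univ_castSucc, mul_add, Finset.mul_sum]
    simp only [belowNorm, Fin.val_zero, if_true]
    have h : ∀ j : Fin n, δ ^ j.succ.val * ∑ s, (if j.succ.val = 0 then 0 else
        ‖D ⟨j.succ.val - 1, lt_of_le_of_lt (Nat.sub_le _ _) j.succ.isLt⟩ s‖) ^ 2 =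
        δ * (δ ^ j.castSucc.val * ∑ x, ‖D j.castSucc x‖ ^ 2) := fun j => by
      simp only [Fin.val_succ, Nat.add_sub_cancel, Nat.succ_ne_zero, if_false, Fin.val_castSucc,
        pow_succ']
      rw [mul_assoc]
      rfl
    simp_rw [h]
    have : 0 ≤ δ * (δ ^ (Fin.last n).val * ∑ x, ‖D (Fin.last n) x‖ ^ 2) := by positivity
    simpa [Finset.mul_sum] using this

variable [InnerProductSpace ℝ E] [Fintype A]

/-- `G` is a sampled target map on the set `𝒰` of stacks: it is nonexpansive with respect to the
layer below, and `Ustar` is its fixed point in the mean for the transition weights `w`. -/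
structure IsSampledTarget (w : S → A → S → ℝ) (𝒰 : Set (Fin H → S → E))
    (G : (Fin H → S → E) → S → A → S → Fin H → E) (Ustar : Fin H → S → E) : Prop where
  star_mem : Ustar ∈ 𝒰
  step_mem : ∀ U ∈ 𝒰, ∀ (c : ℝ) s a s', U + c • increment G U s a s' ∈ 𝒰
  nonexpansive : ∀ U ∈ 𝒰, ∀ U' ∈ 𝒰, ∀ s a s' i,
    ‖G U s a s' i - G U' s a s' i‖ ≤ belowNorm (U - U') i s'
  mean : ∀ i s, ∑ a, ∑ s', w s a s' • G Ustar s a s' i = Ustar i s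

variable {w : S → A → S → ℝ} {𝒰 : Set (Fin H → S → E)}
  {G : (Fin H → S → E) → S → A → S → Fin H → E} {Ustar : Fin H → S → E}

lemma IsSampledTarget.norm_increment_sub_le (hG : IsSampledTarget w 𝒰 G Ustar)
    {U U' : Fin H → S → E} (hU : U ∈ 𝒰) (hU' : U' ∈ 𝒰) (s : S) (a : A) (s' : S) :
    ‖increment G U s a s' - increment G U' s a s'‖ ≤ 2 * ‖U - U'‖ := by
  refine norm_stack_le (by positivity) fun i x => ?_
  simp only [Pi.sub_apply, increment]
  split_ifs
  · rw [sub_sub_sub_comm]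
    have h1 := hG.nonexpansive U hU U' hU' s a s' i
    have h2 := belowNorm_le (U - U') i s'
    have h3 := norm_block_le (U - U') i s
    have h4 := norm_sub_le (G U s a s' i - G U' s a s' i) (U i s - U' i s)
    simp only [Pi.sub_apply] at h3
    linarith
  · simp

/-- Inside an episode with total step size at most `1 / 4` the stack moves by at most a multiple of
the sum of the steps. -/
lemma IsSampledTarget.norm_drift_le (hG : IsSampledTarget w 𝒰 G Ustar) {b : ℝ}
    (hb : ∀ s a s', ‖increment G Ustar s a s'‖ ≤ b) (hb0 : 0 ≤ b) {a : ℕ → ℝ} (ha : ∀ t, 0 ≤ a t)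
    (hA : ∑ t ∈ Finset.range H, a t ≤ 1 / 4) {e : Episode H S A} {W : ℕ → Fin H → S → E}
    (hW0 : ∀ t, W t ∈ 𝒰)
    (hW : ∀ t : Fin H, W (t + 1) =
      W t + a t • increment G (W t) (e.1 t.castSucc) (e.2 t) (e.1 t.succ))
    {n : ℕ} (hn : n ≤ H) :
    ‖W n - W 0‖ ≤ 2 * (∑ t ∈ Finset.range n, a t) * (2 * ‖W 0 - Ustar‖ + b) := by
  induction n with
  | zero => simp
  | succ n ih =>
    have ih := ih (Nat.le_of_succ_le hn)
    have hAn : ∑ t ∈ Finset.range n, a t ≤ 1 / 4 :=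
      (Finset.sum_le_sum_of_subset_of_nonneg
        (Finset.range_subset_range.2 (Nat.le_of_succ_le hn)) fun t _ _ => ha t).trans hA
    rw [Finset.sum_range_succ, hW ⟨n, hn⟩]
    set D := increment G (W n) (e.1 (Fin.castSucc ⟨n, hn⟩)) (e.2 ⟨n, hn⟩)
      (e.1 (Fin.succ ⟨n, hn⟩)) with hD
    have h1 : ‖D‖ ≤ 2 * ‖W n - Ustar‖ + b := by
      have h2 := hG.norm_increment_sub_le (hW0 n) hG.star_mem (e.1 (Fin.castSucc ⟨n, hn⟩))
        (e.2 ⟨n, hn⟩) (e.1 (Fin.succ ⟨n, hn⟩))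
      have h3 := hb (e.1 (Fin.castSucc ⟨n, hn⟩)) (e.2 ⟨n, hn⟩) (e.1 (Fin.succ ⟨n, hn⟩))
      have h4 := norm_le_norm_sub_add D
        (increment G Ustar (e.1 (Fin.castSucc ⟨n, hn⟩)) (e.2 ⟨n, hn⟩) (e.1 (Fin.succ ⟨n, hn⟩)))
      linarith
    have h2 : ‖W n - Ustar‖ ≤ ‖W n - W 0‖ + ‖W 0 - Ustar‖ := norm_sub_le_norm_sub_add_norm_sub ..
    have h3 : ‖W n + a n • D - W 0‖ ≤ ‖W n - W 0‖ + a n * ‖D‖ := by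
      rw [add_sub_right_comm]
      refine (norm_add_le _ _).trans ?_
      rw [norm_smul, Real.norm_of_nonneg (ha n)]
    have h5 : 0 ≤ 2 * ‖W 0 - Ustar‖ + b := by positivity
    set y := 2 * ‖W 0 - Ustar‖ + b with hy
    have h6 : ‖D‖ ≤ 2 * y := by
      have : 2 * (∑ t ∈ Finset.range n, a t) * y ≤ 2 * (1 / 4) * y := by gcongr
      linarith
    have h7 := mul_le_mul_of_nonneg_left h6 (ha n)
    calc _ ≤ ‖W n - W 0‖ + a n * ‖D‖ := h3
      _ ≤ 2 * (∑ t ∈ Finset.range n, a t) * y + a n * (2 * y) := by gcongr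
      _ = _ := by ring

/-- Expansion of the squared error of a block over one episode, to second order in the total step
size: the first order part is evaluated at the initial stack. -/
lemma IsSampledTarget.norm_sq_le (hG : IsSampledTarget w 𝒰 G Ustar) {b : ℝ}
    (hb : ∀ s a s', ‖increment G Ustar s a s'‖ ≤ b) (hb0 : 0 ≤ b) {a : ℕ → ℝ} (ha : ∀ t, 0 ≤ a t)
    (hA : ∑ t ∈ Finset.range H, a t ≤ 1 / 4) {e : Episode H S A} {W : ℕ → Fin H → S → E}
    (hW0 : ∀ t, W t ∈ 𝒰)
    (hW : ∀ t : Fin H, W (t + 1) =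
      W t + a t • increment G (W t) (e.1 t.castSucc) (e.2 t) (e.1 t.succ)) (i : Fin H) (x : S) :
    ‖W H i x - Ustar i x‖ ^ 2 ≤ ‖W 0 i x - Ustar i x‖ ^ 2
      + ∑ t : Fin H, a t * (2 * inner ℝ (W 0 i x - Ustar i x)
          (increment G (W 0) (e.1 t.castSucc) (e.2 t) (e.1 t.succ) i x))
      + (∑ t ∈ Finset.range H, a t) ^ 2 * (64 * ‖W 0 - Ustar‖ ^ 2 + 16 * b ^ 2) := by
  have hdrift := fun {n : ℕ} (hn : n ≤ H) => hG.norm_drift_le hb hb0 ha hA hW0 hW hn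
  set T := ∑ t ∈ Finset.range H, a t with hT
  have hT0 : 0 ≤ T := Finset.sum_nonneg fun t _ => ha t
  set F : Fin H → Fin H → S → E :=
    fun t => increment G (W 0) (e.1 t.castSucc) (e.2 t) (e.1 t.succ) with hF
  set y := 2 * ‖W 0 - Ustar‖ + b with hy
  have hy0 : 0 ≤ y := by positivity
  have htel : W H - W 0 - ∑ t : Fin H, a t • F t = ∑ t : Fin H, a t •
      (increment G (W t) (e.1 t.castSucc) (e.2 t) (e.1 t.succ) - F t) := by
    rw [← Finset.sum_range_sub, ← Fin.sum_univ_eq_sum_range (fun t => W (t + 1) - W t),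
      ← Finset.sum_sub_distrib]
    refine Finset.sum_congr rfl fun t _ => ?_
    rw [hW t, add_sub_cancel_left, smul_sub]
  have hR : ‖W H - W 0 - ∑ t : Fin H, a t • F t‖ ≤ 4 * T ^ 2 * y := by
    rw [htel]
    calc _ ≤ ∑ t : Fin H, a t * (4 * T * y) := by
          refine norm_sum_le_of_le _ fun t _ => ?_
          rw [norm_smul, Real.norm_of_nonneg (ha t)]
          refine mul_le_mul_of_nonneg_left ?_ (ha t)
          have h1 := hG.norm_increment_sub_le (hW0 t) (hW0 0) (e.1 t.castSucc) (e.2 t)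
            (e.1 t.succ)
          have h2 := hdrift t.isLt.le
          have h3 : ∑ u ∈ Finset.range t, a u ≤ T := Finset.sum_le_sum_of_subset_of_nonneg
            (Finset.range_subset_range.2 t.isLt.le) fun u _ _ => ha u
          have h4 := mul_le_mul_of_nonneg_right h3 hy0
          linarith
      _ = _ := by
          rw [← Finset.sum_mul, Fin.sum_univ_eq_sum_range a H, ← hT]
          ring
  have hd := hdrift le_rfl
  have hRi := (norm_block_le _ i x).trans hR
  have hdi := (norm_block_le _ i x).trans hd
  have hDi := norm_block_le (W 0 - Ustar) i x
  simp only [Pi.sub_apply, Finset.sum_apply, Pi.smul_apply] at hRi hdi hDi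
  set D := W 0 i x - Ustar i x with hD
  set d := W H i x - W 0 i x with hd'
  set L := ∑ t : Fin H, a t • F t i x with hL
  have h1 : W H i x - Ustar i x = D + d := by rw [hD, hd']; abel
  have h2 : ∑ t : Fin H, a t * (2 * inner ℝ D (F t i x)) = 2 * inner ℝ D L := by
    rw [hL, inner_sum, Finset.mul_sum]
    refine Finset.sum_congr rfl fun t _ => ?_
    rw [inner_smul_right]; ring
  have h3 : inner ℝ D d ≤ inner ℝ D L + ‖D‖ * ‖d - L‖ := by
    have h4 := real_inner_le_norm D (d - L)
    rw [inner_sub_right] at h4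
    linarith
  have hDy : ‖D‖ ≤ y / 2 := by rw [hy]; linarith
  have h4 : ‖D‖ * ‖d - L‖ ≤ y / 2 * (4 * T ^ 2 * y) := by gcongr
  have h5 : ‖d‖ ^ 2 ≤ (2 * T * y) ^ 2 := by gcongr
  have h6 : y ^ 2 ≤ 8 * ‖W 0 - Ustar‖ ^ 2 + 2 * b ^ 2 := by
    rw [hy]; nlinarith [sq_nonneg (2 * ‖W 0 - Ustar‖ - b)]
  have h7 := mul_le_mul_of_nonneg_left h6 (sq_nonneg T)
  rw [h1, norm_add_sq_real, h2]
  nlinarith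

/-- The first order part of the squared error, for one transition. -/
lemma IsSampledTarget.inner_increment_le (hG : IsSampledTarget w 𝒰 G Ustar)
    {U : Fin H → S → E} (hU : U ∈ 𝒰) (s : S) (a : A) (s' : S) (i : Fin H) (x : S) [Decidable (s = x)] :
    2 * inner ℝ (U i x - Ustar i x) (increment G U s a s' i x) ≤
      if s = x then belowNorm (U - Ustar) i s' ^ 2 - ‖U i x - Ustar i x‖ ^ 2
        + 2 * inner ℝ (U i x - Ustar i x) (G Ustar x a s' i - Ustar i x) else 0 := by
  by_cases h : s = x
  · subst h
    simp only [increment, if_true]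
    have h1 := hG.nonexpansive U hU Ustar hG.star_mem s a s' i
    set D := U i s - Ustar i s with hD
    have h2 : G U s a s' i - U i s =
        (G U s a s' i - G Ustar s a s' i) + (G Ustar s a s' i - Ustar i s) - D := by
      rw [hD]; abel
    rw [h2, inner_sub_right, inner_add_right, real_inner_self_eq_norm_sq]
    have h3 := real_inner_le_norm D (G U s a s' i - G Ustar s a s' i)
    have h4 := mul_le_mul_of_nonneg_left h1 (norm_nonneg D)
    nlinarith [sq_nonneg (‖D‖ - belowNorm (U - Ustar) i s')]
  · simp [increment, h, Ne.symm h]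

open Classical in
/-- The expected squared error of a block after one episode. -/
lemma IsSampledTarget.sum_norm_sq_le (hG : IsSampledTarget w 𝒰 G Ustar)
    (hw0 : ∀ s a s', 0 ≤ w s a s') (hw : ∀ s, ∑ a, ∑ s', w s a s' = 1)
    {ν : S → ℝ} (hν0 : ∀ s, 0 ≤ ν s) (hν : ∑ s, ν s = 1) {b : ℝ}
    (hb : ∀ s a s', ‖increment G Ustar s a s'‖ ≤ b) (hb0 : 0 ≤ b) {a : ℕ → ℝ} (ha : ∀ t, 0 ≤ a t)
    (hA : ∑ t ∈ Finset.range H, a t ≤ 1 / 4) {U : Fin H → S → E}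
    {W : Episode H S A → ℕ → Fin H → S → E} (hWU : ∀ e, W e 0 = U) (hW0 : ∀ e t, W e t ∈ 𝒰)
    (hW : ∀ e, ∀ t : Fin H, W e (t + 1) =
      W e t + a t • increment G (W e t) (e.1 t.castSucc) (e.2 t) (e.1 t.succ))
    (i : Fin H) (x : S) :
    ∑ e, pathWeight w ν e * ‖W e H i x - Ustar i x‖ ^ 2 ≤ ‖U i x - Ustar i x‖ ^ 2
      + ∑ t : Fin H, a t *
        ((∑ e : Episode H S A, if e.1 t.castSucc = x then pathWeight w ν e else 0) *
          ((∑ s', belowNorm (U - Ustar) i s' ^ 2) - ‖U i x - Ustar i x‖ ^ 2))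
      + (∑ t ∈ Finset.range H, a t) ^ 2 * (64 * ‖U - Ustar‖ ^ 2 + 16 * b ^ 2) := by
  have hp0 : ∀ e : Episode H S A, 0 ≤ pathWeight w ν e := fun e =>
    mul_nonneg (hν0 _) (Finset.prod_nonneg fun t _ => hw0 _ _ _)
  have hp1 : ∑ e : Episode H S A, pathWeight w ν e = 1 := sum_pathWeight hw hν
  have hU : U ∈ 𝒰 := by
    obtain ⟨e⟩ : Nonempty (Episode H S A) := by
      by_contra h
      rw [not_nonempty_iff] at h
      simp at hp1
    exact hWU e ▸ hW0 e 0
  set T := ∑ t ∈ Finset.range H, a t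
  set D := U i x - Ustar i x with hD
  set f : A → S → ℝ := fun α s' => belowNorm (U - Ustar) i s' ^ 2 - ‖D‖ ^ 2
        + 2 * inner ℝ D (G Ustar x α s' i - Ustar i x) with hf
  have hpt : ∀ e, ‖W e H i x - Ustar i x‖ ^ 2 ≤ ‖D‖ ^ 2
      + ∑ t : Fin H, a t * (if e.1 t.castSucc = x then f (e.2 t) (e.1 t.succ) else 0)
      + T ^ 2 * (64 * ‖U - Ustar‖ ^ 2 + 16 * b ^ 2) := fun e => by
    have h := hG.norm_sq_le hb hb0 ha hA (hW0 e) (hW e) i x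
    rw [hWU e] at h
    refine h.trans ?_
    gcongr with t _
    · exact ha t
    · exact hG.inner_increment_le hU _ _ _ _ _
  -- the noise has mean zero given the visited state
  have hmean : ∑ α, ∑ s', w x α s' * f α s' ≤
      (∑ s', belowNorm (U - Ustar) i s' ^ 2) - ‖D‖ ^ 2 := by
    have h1 : ∑ α, ∑ s', w x α s' * inner ℝ D (G Ustar x α s' i - Ustar i x) = 0 := by
      have : ∑ α, ∑ s', w x α s' • (G Ustar x α s' i - Ustar i x) = 0 := by
        simp only [smul_sub, Finset.sum_sub_distrib, hG.mean i x, ← Finset.sum_smul, hw,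
          one_smul, sub_self]
      rw [← inner_zero_right D (𝕜 := ℝ), ← this]
      simp only [inner_sum, inner_smul_right]
    have h2 : ∑ α, ∑ s', w x α s' * belowNorm (U - Ustar) i s' ^ 2 ≤
        ∑ s', belowNorm (U - Ustar) i s' ^ 2 := by
      rw [Finset.sum_comm]
      refine Finset.sum_le_sum fun s' _ => ?_
      rw [← Finset.sum_mul]
      refine mul_le_of_le_one_left (sq_nonneg _) ?_
      rw [← hw x]
      exact Finset.sum_le_sum fun α _ =>
        Finset.single_le_sum (f := fun s' => w x α s') (fun _ _ => hw0 _ _ _) (Finset.mem_univ s')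
    have h3 : ∑ α, ∑ s', w x α s' * f α s' =
        ∑ α, ∑ s', w x α s' * belowNorm (U - Ustar) i s' ^ 2
          - (∑ α, ∑ s', w x α s') * ‖D‖ ^ 2
          + 2 * ∑ α, ∑ s', w x α s' * inner ℝ D (G Ustar x α s' i - Ustar i x) := by
      simp only [Finset.sum_mul, Finset.mul_sum, ← Finset.sum_sub_distrib,
        ← Finset.sum_add_distrib]
      exact Finset.sum_congr rfl fun _ _ => Finset.sum_congr rfl fun _ _ => by
        simp only [hf]; ring
    rw [h3, h1, hw]
    linarith
  calc ∑ e, pathWeight w ν e * ‖W e H i x - Ustar i x‖ ^ 2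
      ≤ ∑ e, pathWeight w ν e * (‖D‖ ^ 2
        + ∑ t : Fin H, a t * (if e.1 t.castSucc = x then f (e.2 t) (e.1 t.succ) else 0)
        + T ^ 2 * (64 * ‖U - Ustar‖ ^ 2 + 16 * b ^ 2)) :=
        Finset.sum_le_sum fun e _ => mul_le_mul_of_nonneg_left (hpt e) (hp0 e)
    _ = ‖D‖ ^ 2 + ∑ t : Fin H, a t * (∑ e, pathWeight w ν e *
          (if e.1 t.castSucc = x then f (e.2 t) (e.1 t.succ) else 0))
        + T ^ 2 * (64 * ‖U - Ustar‖ ^ 2 + 16 * b ^ 2) := by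
        simp only [mul_add, Finset.sum_add_distrib, ← Finset.sum_mul, hp1, one_mul]
        congr 2
        simp only [Finset.mul_sum]
        rw [Finset.sum_comm]
        exact Finset.sum_congr rfl fun _ _ => Finset.sum_congr rfl fun _ _ => by ring
    _ ≤ _ := by
        gcongr with t _
        · exact ha t
        · rw [sum_pathWeight_transition hw]
          refine mul_le_mul_of_nonneg_left hmean (Finset.sum_nonneg fun e _ => ?_)
          split_ifs
          exacts [hp0 e, le_rfl]

open Classical in
/-- The drift inequality of one episode for the Lyapunov function, where `2 * δ` is a lower bound of
the phase laws. -/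
lemma IsSampledTarget.sum_lyapunov_le (hG : IsSampledTarget w 𝒰 G Ustar)
    (hw0 : ∀ s a s', 0 ≤ w s a s') (hw : ∀ s, ∑ a, ∑ s', w s a s' = 1)
    {ν : S → ℝ} (hν0 : ∀ s, 0 ≤ ν s) (hν : ∑ s, ν s = 1) {b : ℝ}
    (hb : ∀ s a s', ‖increment G Ustar s a s'‖ ≤ b) (hb0 : 0 ≤ b) {δ : ℝ} (hδ : 0 < δ)
    (hδ1 : δ ≤ 1)
    (hphase : ∀ (t : Fin H) (x : S),
      2 * δ ≤ ∑ e : Episode H S A, if e.1 t.castSucc = x then pathWeight w ν e else 0)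
    {a : ℕ → ℝ} (ha : ∀ t, 0 ≤ a t) (hA : ∑ t ∈ Finset.range H, a t ≤ 1 / 4)
    (hAδ : (∑ t ∈ Finset.range H, a t) * (H * Fintype.card S * (64 / δ ^ H)) ≤ δ / 2)
    {U : Fin H → S → E}
    {W : Episode H S A → ℕ → Fin H → S → E} (hWU : ∀ e, W e 0 = U) (hW0 : ∀ e t, W e t ∈ 𝒰)
    (hW : ∀ e, ∀ t : Fin H, W e (t + 1) =
      W e t + a t • increment G (W e t) (e.1 t.castSucc) (e.2 t) (e.1 t.succ)) :
    ∑ e, pathWeight w ν e * lyapunov δ (W e H - Ustar) ≤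
      (1 - δ / 2 * ∑ t ∈ Finset.range H, a t) * lyapunov δ (U - Ustar)
        + 16 * H * Fintype.card S * b ^ 2 * (∑ t ∈ Finset.range H, a t) ^ 2 := by
  have hpt := hG.sum_norm_sq_le hw0 hw hν0 hν hb hb0 ha hA hWU hW0 hW
  have hT0 : 0 ≤ ∑ t ∈ Finset.range H, a t := Finset.sum_nonneg fun t _ => ha t
  have hTsum : ∑ t : Fin H, a t = ∑ t ∈ Finset.range H, a t := Fin.sum_univ_eq_sum_range a H
  set T := ∑ t ∈ Finset.range H, a t
  set p : Fin H → S → ℝ := fun t x =>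
    ∑ e : Episode H S A, if e.1 t.castSucc = x then pathWeight w ν e else 0 with hp
  have hp1 : ∀ t, ∑ x, p t x = 1 := fun t => by
    rw [← sum_pathWeight hw hν (H := H) (A := A), hp, Finset.sum_comm]
    simp
  set D := U - Ustar with hD
  set K : ℝ := 64 * ‖D‖ ^ 2 + 16 * b ^ 2 with hK
  set β : Fin H → ℝ := fun i => ∑ s', belowNorm D i s' ^ 2 with hβ
  -- sum over the states
  have hlayer : ∀ i, ∑ x, ∑ e, pathWeight w ν e * ‖W e H i x - Ustar i x‖ ^ 2 ≤
      (1 - 2 * δ * T) * ∑ x, ‖D i x‖ ^ 2 + T * β i + Fintype.card S * (T ^ 2 * K) := fun i => by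
    have h1 : ∀ t : Fin H, ∑ x, p t x * (β i - ‖D i x‖ ^ 2) ≤
        β i - 2 * δ * ∑ x, ‖D i x‖ ^ 2 := fun t => by
      simp only [mul_sub, Finset.sum_sub_distrib, ← Finset.sum_mul, hp1, one_mul, Finset.mul_sum]
      gcongr with x
      exact hphase t x
    calc _ ≤ ∑ x, (‖D i x‖ ^ 2 + ∑ t : Fin H, a t * (p t x * (β i - ‖D i x‖ ^ 2)) + T ^ 2 * K) :=
          Finset.sum_le_sum fun x _ => hpt i x
      _ = ∑ x, ‖D i x‖ ^ 2 + ∑ t : Fin H, a t * ∑ x, p t x * (β i - ‖D i x‖ ^ 2)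
            + Fintype.card S * (T ^ 2 * K) := by
          simp only [Finset.sum_add_distrib, Finset.mul_sum, Finset.sum_const, Finset.card_univ,
            nsmul_eq_mul]
          congr 2
          exact Finset.sum_comm
      _ ≤ ∑ x, ‖D i x‖ ^ 2 + ∑ t : Fin H, a t * (β i - 2 * δ * ∑ x, ‖D i x‖ ^ 2)
            + Fintype.card S * (T ^ 2 * K) := by
          gcongr with t
          · exact ha t
          · exact h1 t
      _ = _ := by
          rw [← Finset.sum_mul, hTsum]; ring
  have hV0 := lyapunov_nonneg hδ.le D
  have hbelow := mul_le_mul_of_nonneg_left (sum_belowNorm_sq_le hδ.le D) hT0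
  have hnorm := norm_sq_le_lyapunov hδ hδ1 D
  have hmain : ∑ e, pathWeight w ν e * lyapunov δ (W e H - Ustar) ≤
      (1 - 2 * δ * T) * lyapunov δ D + T * (∑ i, δ ^ i.val * β i)
        + H * (Fintype.card S * (T ^ 2 * K)) := by
    calc _ = ∑ i : Fin H, δ ^ i.val *
          ∑ x, ∑ e, pathWeight w ν e * ‖W e H i x - Ustar i x‖ ^ 2 := by
          simp only [lyapunov, Finset.mul_sum, Pi.sub_apply]
          rw [Finset.sum_comm]
          refine Finset.sum_congr rfl fun i _ => ?_
          rw [Finset.sum_comm]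
          exact Finset.sum_congr rfl fun _ _ => Finset.sum_congr rfl fun _ _ => by ring
      _ ≤ ∑ i : Fin H, (δ ^ i.val * ((1 - 2 * δ * T) * ∑ x, ‖D i x‖ ^ 2 + T * β i)
            + Fintype.card S * (T ^ 2 * K)) := by
          refine Finset.sum_le_sum fun i _ => ?_
          have h1 := mul_le_mul_of_nonneg_left (hlayer i) (pow_nonneg hδ.le i.val)
          have h2 : δ ^ i.val * (Fintype.card S * (T ^ 2 * K)) ≤ Fintype.card S * (T ^ 2 * K) :=
            mul_le_of_le_one_left (by positivity) (pow_le_one₀ hδ.le hδ1)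
          rw [mul_add] at h1
          linarith
      _ = _ := by
          rw [Finset.sum_add_distrib, lyapunov, Finset.mul_sum _ _ (1 - 2 * δ * T),
            Finset.mul_sum _ _ T]
          simp only [Finset.sum_const, Finset.card_univ, Fintype.card_fin, nsmul_eq_mul]
          rw [← Finset.sum_add_distrib]
          congr 1
          exact Finset.sum_congr rfl fun i _ => by ring
  set V := lyapunov δ D
  have h2 : H * (Fintype.card S * (T ^ 2 * K)) ≤
      T * (δ / 2) * V + 16 * H * Fintype.card S * b ^ 2 * T ^ 2 := by
    have h3 : (H : ℝ) * Fintype.card S * T ^ 2 * (64 * ‖D‖ ^ 2) ≤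
        H * Fintype.card S * T ^ 2 * (64 * (V / δ ^ H)) := by gcongr
    have h4 := mul_le_mul_of_nonneg_right hAδ (mul_nonneg hT0 hV0)
    have h5 : T * (H * Fintype.card S * (64 / δ ^ H)) * (T * V) =
      H * Fintype.card S * T ^ 2 * (64 * (V / δ ^ H)) := by ring
    rw [h5] at h4
    rw [hK]
    linarith
  linarith

end Core

/-! ### The fixed point and the sampled targets -/

section Bellman

variable {S A : Type*} {q d H : ℕ} {κ : Vec q → Vec q → ℝ} {Θ : Supports H S d q}

lemma mass_below {η : LawStack H S q} (hη : η ∈ categoricalStacks Θ) (i : Fin H) (s : S) :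
    mass (below η i s) = 1 := by
  rw [below]
  split_ifs
  · exact mass_dirac 0
  · exact mass_of_mem_signedCategorical (hη _ _)

lemma IsMassZeroKernel.unembedStack_embedStack (hκ : IsMassZeroKernel κ)
    (hΘ : ∀ i s, Function.Injective (Θ i s)) {η : LawStack H S q} (hη : η ∈ categoricalStacks Θ) :
    unembedStack κ Θ (embedStack κ Θ η) = η :=
  funext fun i => funext fun s => hκ.unembed_embed (hΘ i s) (hη i s)

variable [Fintype S] [Fintype A] {M : MDP S A q} {π : S → A → ℝ}

/-- The transition weights `π(a ∣ s) P(s' ∣ s, a)`. -/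
def transition (M : MDP S A q) (π : S → A → ℝ) (s : S) (a : A) (s' : S) : ℝ := π s a * M.P s a s'

lemma transition_nonneg (hπ : ∀ s, π s ∈ stdSimplex ℝ A) (s : S) (a : A) (s' : S) :
    0 ≤ transition M π s a s' :=
  mul_nonneg ((hπ s).1 a) ((M.P_mem s a).1 s')

lemma sum_transition (hπ : ∀ s, π s ∈ stdSimplex ℝ A) (s : S) :
    ∑ a, ∑ s', transition M π s a s' = 1 := by
  simp only [transition, ← Finset.mul_sum, (M.P_mem s _).2, mul_one, (hπ s).2]

lemma mass_sum_shift (hπ : ∀ s, π s ∈ stdSimplex ℝ A) {ν : S → SignedLaw q}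
    (hν : ∀ s, mass (ν s) = 1) (s : S) :
    mass (∑ a, ∑ s', (π s a * M.P s a s') • shift (M.R s a) (ν s')) = 1 := by
  simp only [map_sum, map_smul, mass_shift, hν, smul_eq_mul, mul_one]
  exact sum_transition hπ s

/-- The layers of the fixed point of the projected Bellman operator, by recursion on the horizon:
each layer is determined by the one below it. -/
def fixedLayer (κ : Vec q → Vec q → ℝ) (Θ : Supports H S d q) (M : MDP S A q) (π : S → A → ℝ) :
    ℕ → S → SignedLaw q
  | 0 => fun _ => dirac 0
  | h + 1 => fun s => if hh : h < H then
      proj κ (Θ ⟨h, hh⟩ s)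
        (∑ a, ∑ s', (π s a * M.P s a s') • shift (M.R s a) (fixedLayer κ Θ M π h s'))
      else dirac 0

/-- The fixed point of the projected Bellman operator. -/
def fixedStack (κ : Vec q → Vec q → ℝ) (Θ : Supports H S d q) (M : MDP S A q) (π : S → A → ℝ) :
    LawStack H S q :=
  fun i s => fixedLayer κ Θ M π (i.val + 1) s

lemma below_fixedStack (i : Fin H) (s : S) :
    below (fixedStack κ Θ M π) i s = fixedLayer κ Θ M π i.val s := by
  obtain ⟨i, hi⟩ := i
  cases i with
  | zero => simp [below, fixedLayer]
  | succ n => simp [below, fixedStack]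

lemma projBellman_fixedStack : projBellman κ Θ M π (fixedStack κ Θ M π) = fixedStack κ Θ M π := by
  funext i s
  simp [projBellman, bellman, below_fixedStack, fixedStack, fixedLayer]

lemma eq_of_projBellman_eq {η η' : LawStack H S q} (h : projBellman κ Θ M π η = η)
    (h' : projBellman κ Θ M π η' = η') : η = η' := by
  have key : ∀ n (hn : n < H), η ⟨n, hn⟩ = η' ⟨n, hn⟩ := fun n => by
    induction n with
    | zero =>
      intro hn
      rw [← h, ← h']
      funext s
      simp [projBellman, bellman, below]
    | succ n ih =>
      intro hn
      rw [← h, ← h']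
      funext s
      simp [projBellman, bellman, below, ih (Nat.lt_of_succ_lt hn)]
  exact funext fun i => key i.1 i.2

lemma IsMassZeroKernel.fixedStack_mem (hκ : IsMassZeroKernel κ) (hd : 1 ≤ d)
    (hπ : ∀ s, π s ∈ stdSimplex ℝ A) : fixedStack κ Θ M π ∈ categoricalStacks Θ := by
  have hmass : ∀ h s, mass (fixedLayer κ Θ M π h s) = 1 := fun h => by
    induction h with
    | zero => exact fun s => mass_dirac 0
    | succ h ih =>
      intro s
      rw [fixedLayer]
      split_ifs
      · exact mass_of_mem_signedCategorical (hκ.proj_mem hd (mass_sum_shift hπ ih s))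
      · exact mass_dirac 0
  intro i s
  simp only [fixedStack, fixedLayer, i.isLt, dif_pos]
  exact hκ.proj_mem hd (mass_sum_shift hπ (hmass _) s)

/-- The embedded sampled targets are nonexpansive and have the embedded fixed point as their fixed
point in the mean. -/
lemma IsMassZeroKernel.isSampledTarget (hκ : IsMassZeroKernel κ) (hd : 1 ≤ d)
    (hπ : ∀ s, π s ∈ stdSimplex ℝ A) (hΘ : ∀ i s, Function.Injective (Θ i s)) :
    IsSampledTarget (transition M π) (embedStack κ Θ '' categoricalStacks Θ)
      (fun U s a s' i => sampledTarget κ Θ U s (M.R s a) s' i)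
      (embedStack κ Θ (fixedStack κ Θ M π)) where
  star_mem := ⟨_, hκ.fixedStack_mem hd hπ, rfl⟩
  step_mem := by
    rintro _ ⟨η, hη, rfl⟩ c s a s'
    classical
    refine ⟨fun i x => if x = s then η i x + c • (proj κ (Θ i x)
      (shift (M.R s a) (below η i s')) - η i x) else η i x, fun i x => ?_, ?_⟩
    · dsimp only
      split_ifs
      · exact affine_mem_signedCategorical (hη i x)
          (hκ.proj_mem hd (by rw [mass_shift, mass_below hη])) c
      · exact hη i x
    · funext i x
      simp only [embedStack, Pi.add_apply, Pi.smul_apply, increment, sampledTarget]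
      have h := hκ.unembedStack_embedStack hΘ hη
      by_cases hx : x = s
      · subst hx
        simp only [if_true]
        change _ = embed κ (Θ i x) (η i x) + c • (embed κ (Θ i x) (proj κ (Θ i x) (shift (M.R x a)
          (below (unembedStack κ Θ (embedStack κ Θ η)) i s'))) - embed κ (Θ i x) (η i x))
        rw [h]
        simp only [← embedLinear_apply, map_add, map_smul, map_sub]
      · simp [hx]
  nonexpansive := by
    rintro _ ⟨η, hη, rfl⟩ _ ⟨η', hη', rfl⟩ s a s' i
    have hm := mass_below hη i s'
    have hm' := mass_below hη' i s'
    simp only [sampledTarget, hκ.unembedStack_embedStack hΘ hη,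
      hκ.unembedStack_embedStack hΘ hη']
    have hs := fun ν (hν : mass ν = 1) => (mass_shift (M.R s a) ν).trans hν
    rw [hκ.norm_embed_sub (hΘ i s) (hκ.proj_mem hd (hs _ hm)) (hκ.proj_mem hd (hs _ hm'))]
    refine (hκ.mmd_proj_le hd (hs _ hm) (hs _ hm')).trans ?_
    rw [hκ.mmd_shift _ hm hm', belowNorm, below, below]
    split_ifs
    · simp [mmd]
    · exact (hκ.norm_embed_sub (hΘ _ _) (hη _ _) (hη' _ _)).ge
  mean i s := by
    have hη := hκ.fixedStack_mem (Θ := Θ) (M := M) hd hπ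
    simp only [sampledTarget, hκ.unembedStack_embedStack hΘ hη]
    have h1 : projBellman κ Θ M π (fixedStack κ Θ M π) i s = fixedStack κ Θ M π i s := by
      rw [projBellman_fixedStack]
    rw [embedStack, ← h1, projBellman, bellman]
    have h2 := hκ.proj_sum (θ := Θ i s) hd (fun x : A × S => π s x.1 * M.P s x.1 x.2)
      (by rw [Fintype.sum_prod_type]; exact sum_transition hπ s)
      (fun x => shift (M.R s x.1) (below (fixedStack κ Θ M π) i x.2))
      (fun x => by rw [mass_shift, mass_below hη])
    rw [Fintype.sum_prod_type, Fintype.sum_prod_type] at h2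
    rw [h2]
    simp only [← embedLinear_apply, map_sum, map_smul, transition]

end Bellman

/-! ### The block metric in the embedded space -/

section BlockDist

variable {S : Type*} {q d H : ℕ} {κ : Vec q → Vec q → ℝ} {Θ : Supports H S d q} {lam : ℝ}
  {η η' : LawStack H S q}

lemma blockDist_nonneg (hlam : 0 ≤ lam) : 0 ≤ blockDist κ lam η η' :=
  Real.iSup_nonneg fun _ => mul_nonneg (pow_nonneg hlam _) (Real.sqrt_nonneg _)

variable [Fintype S]

lemma IsMassZeroKernel.blockDist_le (hκ : IsMassZeroKernel κ)
    (hΘ : ∀ i s, Function.Injective (Θ i s)) (hη : η ∈ categoricalStacks Θ)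
    (hη' : η' ∈ categoricalStacks Θ) (hlam : 0 ≤ lam) (hlam1 : lam ≤ 1) :
    blockDist κ lam η η' ≤ ‖embedStack κ Θ η - embedStack κ Θ η'‖ := by
  refine Real.iSup_le (fun x => ?_) (norm_nonneg _)
  have h := norm_block_le (embedStack κ Θ η - embedStack κ Θ η') x.1 x.2
  simp only [Pi.sub_apply, embedStack, hκ.norm_embed_sub (hΘ x.1 x.2) (hη _ _) (hη' _ _)] at h
  exact (mul_le_of_le_one_left (Real.sqrt_nonneg _) (pow_le_one₀ hlam hlam1)).trans h

lemma IsMassZeroKernel.norm_block_le_blockDist (hκ : IsMassZeroKernel κ)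
    (hΘ : ∀ i s, Function.Injective (Θ i s)) (hη : η ∈ categoricalStacks Θ)
    (hη' : η' ∈ categoricalStacks Θ) (hlam : 0 < lam) (hlam1 : lam ≤ 1) (i : Fin H) (s : S) :
    ‖(embedStack κ Θ η - embedStack κ Θ η') i s‖ ≤ blockDist κ lam η η' / lam ^ H := by
  simp only [Pi.sub_apply, embedStack, hκ.norm_embed_sub (hΘ i s) (hη _ _) (hη' _ _)]
  rw [le_div_iff₀ (by positivity), mul_comm]
  calc lam ^ H * mmd κ (η i s) (η' i s) ≤ lam ^ (i.val + 1) * mmd κ (η i s) (η' i s) :=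
        mul_le_mul_of_nonneg_right (pow_le_pow_of_le_one hlam.le hlam1 i.isLt) (Real.sqrt_nonneg _)
    _ ≤ _ := le_ciSup (f := fun x : Fin H × S => lam ^ (x.1.val + 1) * mmd κ (η x.1 x.2)
        (η' x.1 x.2)) (Set.finite_range _).bddAbove (i, s)

end BlockDist

/-! ### Independent episodes -/

section Independence

/-- A function of the first `m` samples factors through a finite type. -/
lemma exists_factor {E : Type*} [Nonempty E] {f : (ℕ → E) → ℝ} {m : ℕ}
    (hf : ∀ p p', (∀ j < m, p j = p' j) → f p = f p') :
    ∃ g : (Finset.range m → E) → ℝ, ∀ p, f p = g fun j => p j := by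
  classical
  refine ⟨fun z => f fun j => if h : j ∈ Finset.range m then z ⟨j, h⟩ else Classical.arbitrary E,
    fun p => hf _ _ fun j hj => ?_⟩
  simp [hj]

variable {Ω E : Type*} [MeasurableSpace Ω] {μ : Measure Ω} [IsProbabilityMeasure μ] [Fintype E]
  [MeasurableSpace E] [MeasurableSingletonClass E] {X : ℕ → Ω → E}

lemma integrable_of_finite_dependence (hX : ∀ m, Measurable (X m)) {f : (ℕ → E) → ℝ} {m : ℕ}
    (hf : ∀ p p', (∀ j < m, p j = p' j) → f p = f p') :
    Integrable (fun ω => f fun j => X j ω) μ := by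
  obtain ⟨ω⟩ := nonempty_of_isProbabilityMeasure μ
  have : Nonempty E := ⟨X 0 ω⟩
  obtain ⟨g, hg⟩ := exists_factor hf
  simp only [hg]
  have hZ : Measurable fun ω (j : Finset.range m) => X j ω := measurable_pi_lambda _ fun j => hX j
  have : IsProbabilityMeasure (μ.map fun ω (j : Finset.range m) => X j ω) :=
    Measure.isProbabilityMeasure_map hZ.aemeasurable
  exact (Integrable.of_finite (f := g)).comp_measurable hZ

/-- Averaging over the sample number `m`, which is independent of the previous ones. -/
lemma integral_eq_sum_update (hX : ∀ m, Measurable (X m)) (hind : iIndepFun X μ)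
    {f : (ℕ → E) → ℝ} {m : ℕ} (hf : ∀ p p', (∀ j < m + 1, p j = p' j) → f p = f p') :
    ∫ ω, f (fun j => X j ω) ∂μ =
      ∑ e, μ.real (X m ⁻¹' {e}) * ∫ ω, f (Function.update (fun j => X j ω) m e) ∂μ := by
  classical
  obtain ⟨ω⟩ := nonempty_of_isProbabilityMeasure μ
  have : Nonempty E := ⟨X 0 ω⟩
  have hf' : ∀ e p p', (∀ j < m, p j = p' j) →
      f (Function.update p m e) = f (Function.update p' m e) := fun e p p' h => by
    refine hf _ _ fun j hj => ?_
    rcases eq_or_ne j m with rfl | hne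
    · simp
    · simp [hne, h j (by omega)]
  have hsplit : ∀ ω, f (fun j => X j ω) = ∑ e, (X m ⁻¹' {e}).indicator (fun _ => (1 : ℝ)) ω *
      f (Function.update (fun j => X j ω) m e) := fun ω => by
    rw [Finset.sum_eq_single (X m ω)]
    · simp
    · intro e _ he
      simp [Set.indicator, he.symm]
    · simp
  have hmeas : ∀ e, MeasurableSet (X m ⁻¹' {e}) := fun e => hX m (measurableSet_singleton e)
  have hterm : ∀ e, Integrable (fun ω => f (Function.update (fun j => X j ω) m e)) μ :=
    fun e => integrable_of_finite_dependence (f := fun p => f (Function.update p m e)) hX (hf' e)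
  simp_rw [hsplit]
  rw [integral_finsetSum]
  · refine Finset.sum_congr rfl fun e _ => ?_
    obtain ⟨g, hg⟩ := exists_factor (hf' e)
    simp only [hg]
    have hI := hind.indepFun_finset (Finset.range m) {m} (by simp) hX
    have hI' := hI.comp (φ := g) (ψ := fun z : ({m} : Finset ℕ) → E =>
      ({e} : Set E).indicator (fun _ => (1 : ℝ)) (z ⟨m, Finset.mem_singleton_self m⟩))
      (measurable_of_finite _) (measurable_of_finite _)
    have hI2 : IndepFun (fun ω => (X m ⁻¹' {e}).indicator (fun _ => (1 : ℝ)) ω)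
        (fun ω => g fun j : Finset.range m => X j ω) μ := hI'.symm
    have hgm : AEStronglyMeasurable (fun ω => g fun j : Finset.range m => X j ω) μ := by
      have := (hterm e).1
      simpa only [hg] using this
    have h1 : ∫ ω, (X m ⁻¹' {e}).indicator (fun _ => (1 : ℝ)) ω ∂μ = μ.real (X m ⁻¹' {e}) :=
      integral_indicator_one (hmeas e)
    rw [hI2.integral_fun_mul_eq_mul_integral
      ((measurable_const.indicator (hmeas e)).aestronglyMeasurable) hgm, h1]
  · intro e _
    have h := (hterm e).indicator (hmeas e)
    refine h.congr (Filter.Eventually.of_forall fun ω => ?_)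
    by_cases hω : ω ∈ X m ⁻¹' {e} <;> simp [hω]

end Independence

/-! ### The recursion along the episodes -/

section Episodes

variable {S A : Type*} [Fintype S] {q d H : ℕ} [NeZero H] {κ : Vec q → Vec q → ℝ}
  {Θ : Supports H S d q} {M : MDP S A q} {α : ℕ → ℝ} {U₀ : EmbStack H S d}

lemma iterate_succ (ep : ℕ → Episode H S A) (m : ℕ) (t : Fin H) :
    iterate κ Θ M α U₀ ep (m * H + t + 1) = iterate κ Θ M α U₀ ep (m * H + t)
      + α (m * H + t) • increment (fun U s a s' i => sampledTarget κ Θ U s (M.R s a) s' i)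
        (iterate κ Θ M α U₀ ep (m * H + t)) ((ep m).1 t.castSucc) ((ep m).2 t)
        ((ep m).1 t.succ) := by
  have h1 : (m * H + t) / H = m := by
    rw [Nat.mul_comm, Nat.mul_add_div (NeZero.pos H), Nat.div_eq_of_lt t.isLt, add_zero]
  have h2 : Fin.ofNat H (m * H + t) = t := by
    ext
    simp [Fin.ofNat, Nat.mod_eq_of_lt t.isLt]
  rw [iterate, h1, h2]
  rfl

/-- The iterates before episode `m` depend on the previous episodes only. -/
lemma iterate_congr {p p' : ℕ → Episode H S A} {m : ℕ} (h : ∀ j < m, p j = p' j) {k : ℕ}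
    (hk : k ≤ m * H) : iterate κ Θ M α U₀ p k = iterate κ Θ M α U₀ p' k := by
  induction k with
  | zero => rfl
  | succ k ih =>
    rw [iterate, iterate, ih (Nat.le_of_succ_le hk),
      h (k / H) ((Nat.div_lt_iff_lt_mul (NeZero.pos H)).2 hk)]

variable [Fintype A] {π : S → A → ℝ}

lemma IsSampledTarget.iterate_mem {w : S → A → S → ℝ} {𝒰 : Set (EmbStack H S d)}
    {Ustar : EmbStack H S d}
    (hG : IsSampledTarget w 𝒰 (fun U s a s' i => sampledTarget κ Θ U s (M.R s a) s' i) Ustar)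
    (hU₀ : U₀ ∈ 𝒰) (ep : ℕ → Episode H S A) (k : ℕ) : iterate κ Θ M α U₀ ep k ∈ 𝒰 := by
  induction k with
  | zero => exact hU₀
  | succ k ih => exact hG.step_mem _ ih _ _ _ _

open Classical in
/-- The mean Lyapunov function at the episode boundaries satisfies a scalar recursion. The constants
do not depend on the step sizes, the starting point and the sample space. -/
lemma IsSampledTarget.integral_lyapunov_le [MeasurableSpace S] [MeasurableSingletonClass S]
    [MeasurableSpace A] [MeasurableSingletonClass A] (hπ : ∀ s, π s ∈ stdSimplex ℝ A)
    {ν₀ : S → ℝ} (hν₀ : ν₀ ∈ stdSimplex ℝ S) {𝒰 : Set (EmbStack H S d)} {Ustar : EmbStack H S d}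
    (hG : IsSampledTarget (transition M π) 𝒰
      (fun U s a s' i => sampledTarget κ Θ U s (M.R s a) s' i) Ustar)
    {b : ℝ} (hb : ∀ s a s', ‖increment (fun U s a s' i => sampledTarget κ Θ U s (M.R s a) s' i)
      Ustar s a s'‖ ≤ b) (hb0 : 0 ≤ b) {δ : ℝ} (hδ : 0 < δ) (hδ1 : δ ≤ 1)
    (hphase : ∀ (t : Fin H) (x : S), 2 * δ ≤ phaseLaw M π ν₀ t x)
    {Ω : Type*} [MeasurableSpace Ω] {μ : Measure Ω} [IsProbabilityMeasure μ]
    {ep : ℕ → Ω → Episode H S A} (hep : IsEpisodicSampling M π ν₀ μ ep) (hU₀ : U₀ ∈ 𝒰)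
    (hα : ∀ k, 0 ≤ α k) {m : ℕ}
    (hA : ∑ t ∈ Finset.range H, α (m * H + t) ≤ 1 / 4)
    (hAδ : (∑ t ∈ Finset.range H, α (m * H + t)) * (H * Fintype.card S * (64 / δ ^ H)) ≤ δ / 2) :
    ∫ ω, lyapunov δ (iterate κ Θ M α U₀ (fun j => ep j ω) ((m + 1) * H) - Ustar) ∂μ ≤
      (1 - δ / 2 * ∑ t ∈ Finset.range H, α (m * H + t)) *
          ∫ ω, lyapunov δ (iterate κ Θ M α U₀ (fun j => ep j ω) (m * H) - Ustar) ∂μ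
        + 16 * H * Fintype.card S * b ^ 2 * (∑ t ∈ Finset.range H, α (m * H + t)) ^ 2 := by
  have hdep : ∀ n, ∀ p p' : ℕ → Episode H S A, (∀ j < n, p j = p' j) →
      lyapunov δ (iterate κ Θ M α U₀ p (n * H) - Ustar) =
        lyapunov δ (iterate κ Θ M α U₀ p' (n * H) - Ustar) := fun n p p' h => by
    rw [iterate_congr h le_rfl]
  have hint : ∀ n, Integrable
      (fun ω => lyapunov δ (iterate κ Θ M α U₀ (fun j => ep j ω) (n * H) - Ustar)) μ := fun n =>
    integrable_of_finite_dependence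
      (f := fun p => lyapunov δ (iterate κ Θ M α U₀ p (n * H) - Ustar)) hep.measurable (hdep n)
  have hint' : ∀ e, Integrable (fun ω => lyapunov δ
      (iterate κ Θ M α U₀ (Function.update (fun j => ep j ω) m e) ((m + 1) * H) - Ustar)) μ :=
    fun e => integrable_of_finite_dependence (m := m + 1)
      (f := fun p => lyapunov δ
        (iterate κ Θ M α U₀ (Function.update p m e) ((m + 1) * H) - Ustar)) hep.measurable
      fun p p' h => hdep _ _ _ fun j hj => by
        by_cases hjm : j = m <;> simp [hjm, h j hj]
  rw [integral_eq_sum_update (f := fun p => lyapunov δ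
    (iterate κ Θ M α U₀ p ((m + 1) * H) - Ustar)) hep.measurable hep.indep (hdep (m + 1))]
  simp_rw [hep.law]
  simp_rw [← integral_const_mul]
  rw [← integral_finsetSum _ fun e _ => (hint' e).const_mul _]
  have hpt : ∀ ω, ∑ e, episodeProb M π ν₀ e * lyapunov δ
      (iterate κ Θ M α U₀ (Function.update (fun j => ep j ω) m e) ((m + 1) * H) - Ustar) ≤
      (1 - δ / 2 * ∑ t ∈ Finset.range H, α (m * H + t)) *
          lyapunov δ (iterate κ Θ M α U₀ (fun j => ep j ω) (m * H) - Ustar)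
        + 16 * H * Fintype.card S * b ^ 2 * (∑ t ∈ Finset.range H, α (m * H + t)) ^ 2 := fun ω => by
    have h := hG.sum_lyapunov_le (transition_nonneg hπ) (sum_transition hπ) hν₀.1 hν₀.2 hb hb0 hδ
      hδ1 hphase (a := fun t => α (m * H + t)) (fun t => hα _) hA hAδ
      (U := iterate κ Θ M α U₀ (fun j => ep j ω) (m * H))
      (W := fun e t => iterate κ Θ M α U₀ (Function.update (fun j => ep j ω) m e) (m * H + t))
      (fun e => iterate_congr (fun j hj => by simp [hj.ne]) le_rfl)
      (fun e t => hG.iterate_mem hU₀ _ _)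
      (fun e t => by
        have h := iterate_succ (κ := κ) (Θ := Θ) (M := M) (α := α) (U₀ := U₀)
          (Function.update (fun j => ep j ω) m e) m t
        rw [Function.update_self] at h
        exact h)
    rw [Nat.succ_mul]
    exact h
  have hR := ((hint m).const_mul (1 - δ / 2 * ∑ t ∈ Finset.range H, α (m * H + t))).add
    (integrable_const
      (16 * H * Fintype.card S * b ^ 2 * (∑ t ∈ Finset.range H, α (m * H + t)) ^ 2))
  refine (integral_mono (integrable_finsetSum _ fun e _ => (hint' e).const_mul _) hR hpt).trans
    (le_of_eq ?_)
  simp only [Pi.add_apply]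
  rw [integral_add ((hint m).const_mul _) (integrable_const _), integral_const_mul]
  simp

lemma MeanSqLE.mono {Ω : Type*} [MeasurableSpace Ω] {μ : Measure Ω} {X : Ω → ℝ} {B B' : ℝ}
    (h : MeanSqLE μ X B) (hB : B ≤ B') : MeanSqLE μ X B' :=
  ⟨h.1, h.2.trans hB⟩

/-- The Lyapunov function dominates the squared block metric. -/
lemma IsMassZeroKernel.meanSqLE_boundaryError [MeasurableSpace S] [MeasurableSingletonClass S]
    [MeasurableSpace A] [MeasurableSingletonClass A] (hκ : IsMassZeroKernel κ) (hd : 1 ≤ d)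
    (hπ : ∀ s, π s ∈ stdSimplex ℝ A) (hΘ : ∀ i s, Function.Injective (Θ i s)) {ν₀ : S → ℝ}
    {lam : ℝ} (hlam : 0 ≤ lam) (hlam1 : lam ≤ 1) {δ : ℝ} (hδ : 0 < δ) (hδ1 : δ ≤ 1)
    {Ω : Type*} [MeasurableSpace Ω] {μ : Measure Ω} [IsProbabilityMeasure μ]
    {ep : ℕ → Ω → Episode H S A} (hep : IsEpisodicSampling M π ν₀ μ ep)
    {η₀ : LawStack H S q} (hη₀ : η₀ ∈ categoricalStacks Θ) (m : ℕ) :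
    MeanSqLE μ (fun ω => boundaryError κ lam Θ M (fixedStack κ Θ M π) η₀ α (fun j => ep j ω) m)
      (1 / δ ^ H * ∫ ω, lyapunov δ (iterate κ Θ M α (embedStack κ Θ η₀) (fun j => ep j ω) (m * H)
        - embedStack κ Θ (fixedStack κ Θ M π)) ∂μ) := by
  have hint : ∀ f : EmbStack H S d → ℝ, Integrable
      (fun ω => f (iterate κ Θ M α (embedStack κ Θ η₀) (fun j => ep j ω) (m * H))) μ := fun f =>
    integrable_of_finite_dependence
      (f := fun p => f (iterate κ Θ M α (embedStack κ Θ η₀) p (m * H))) hep.measurable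
      fun p p' h => by rw [iterate_congr h le_rfl]
  have h1 := hint fun U => blockDist κ lam (unembedStack κ Θ U) (fixedStack κ Θ M π) ^ 2
  refine ⟨h1, ?_⟩
  rw [← integral_const_mul]
  refine integral_mono h1
    ((hint fun U => lyapunov δ (U - embedStack κ Θ (fixedStack κ Θ M π))).const_mul _) fun ω => ?_
  obtain ⟨η, hη, hηU⟩ := (hκ.isSampledTarget hd hπ hΘ (M := M)).iterate_mem (α := α)
    ⟨η₀, hη₀, rfl⟩ (fun j => ep j ω) (m * H)
  dsimp only [boundaryError]
  rw [← hηU, hκ.unembedStack_embedStack hΘ hη, one_div_mul_eq_div]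
  refine le_trans ?_ (norm_sq_le_lyapunov hδ hδ1 _)
  exact pow_le_pow_left₀ (blockDist_nonneg hlam)
    (hκ.blockDist_le hΘ hη (hκ.fixedStack_mem hd hπ) hlam hlam1) 2

end Episodes

end FixedHorizonMTD

end

open FixedHorizonMTD in
theorem theorem4 {S A : Type*} [Fintype S] [Fintype A]
    [MeasurableSpace S] [MeasurableSingletonClass S] [MeasurableSpace A] [MeasurableSingletonClass A]
    {q d H : ℕ} [NeZero H] (hq : 2 ≤ q) (hd : 1 ≤ d)
    -- the decision process, the policy and the reset distribution
    (M : MDP S A q) (π : S → A → ℝ) (hπ : ∀ s, π s ∈ stdSimplex ℝ A)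
    (ν₀ : S → ℝ) (hν₀ : ν₀ ∈ stdSimplex ℝ S) (hρ : 0 < rhoMin H M π ν₀)
    -- the semimetric and the kernel which it induces
    (ρ : Vec q → Vec q → ℝ) (c₀ : ℝ) (z₀ : Vec q) (hc₀ : 0 < c₀) (hsm : IsSemimetric ρ)
    (hneg : IsStrongNegativeType ρ) (hshift : IsShiftInvariant ρ) (hhom : IsHomogeneous c₀ ρ)
    (κ : Vec q → Vec q → ℝ) (hκ : κ = inducedKernel ρ z₀)
    -- the supports and the horizon weight
    (Θ : Supports H S d q) (hΘ : ∀ i s, Function.Injective (Θ i s))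
    (lam : ℝ) (hlam : lam ∈ Set.Ioo (0 : ℝ) 1) :
    -- the projected Bellman operator has a unique fixed point
    ∃ ηstar : LawStack H S q, projBellman κ Θ M π ηstar = ηstar ∧
      (∀ η, projBellman κ Θ M π η = η → η = ηstar) ∧
    ∃ C c αbar : ℝ, 0 < C ∧ 0 < c ∧ 0 < αbar ∧ c * H * αbar < 1 ∧
    ∀ (Ω : Type*) [MeasurableSpace Ω] (μ : MeasureTheory.Measure Ω)
      [MeasureTheory.IsProbabilityMeasure μ] (ep : ℕ → Ω → Episode H S A),
      IsEpisodicSampling M π ν₀ μ ep →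
    ∀ η₀ ∈ categoricalStacks Θ,
      -- constant step size
      (∀ α : ℝ, 0 < α → α ≤ αbar → ∀ m : ℕ,
        MeanSqLE μ
          (fun ω => boundaryError κ lam Θ M ηstar η₀ (fun _ => α) (fun j => ep j ω) m)
          (C * blockDist κ lam η₀ ηstar ^ 2 * (1 - c * H * α) ^ m + C * α)) ∧
      -- linearly diminishing step size
      (∀ α g : ℝ, 1 / c < α → max 1 (α / αbar) ≤ g → ∀ m : ℕ,
        MeanSqLE μ
          (fun ω => boundaryError κ lam Θ M ηstar η₀ (fun k => α / (k + g)) (fun j => ep j ω) m)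
          (C * blockDist κ lam η₀ ηstar ^ 2 * (tau H g 0 / tau H g m) ^ (c * α)
            + C * α ^ 2 / (c * α - 1) * (1 / tau H g m))) ∧
      -- polynomially diminishing step size
      (∀ α g z : ℝ, 0 < α → 0 < z → z < 1 →
        max 1 (max ((α / αbar) ^ (1 / z)) ((2 * z / (c * α)) ^ (1 / (1 - z)))) ≤ g → ∀ m : ℕ,
        MeanSqLE μ
          (fun ω => boundaryError κ lam Θ M ηstar η₀ (fun k => α / (k + g) ^ z)
            (fun j => ep j ω) m)
          (C * blockDist κ lam η₀ ηstar ^ 2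
              * Real.exp (-(c * α / (1 - z)) * (tau H g m ^ (1 - z) - tau H g 0 ^ (1 - z)))
            + C * α / tau H g m ^ z)) := by
  classical
  have hHpos : 1 ≤ H := NeZero.one_le
  have hH : (1 : ℝ) ≤ H := by exact_mod_cast hHpos
  have hK : IsMassZeroKernel κ := hκ ▸ isMassZeroKernel_inducedKernel hsm hneg hshift z₀
  refine ⟨fixedStack κ Θ M π, projBellman_fixedStack,
    fun η hη => eq_of_projBellman_eq hη projBellman_fixedStack, ?_⟩
  have hG := hK.isSampledTarget hd hπ hΘ (M := M)
  set ηstar := fixedStack κ Θ M π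
  set G : EmbStack H S d → S → A → S → Fin H → EuclideanSpace ℝ (Fin d) :=
    fun U s a s' i => sampledTarget κ Θ U s (M.R s a) s' i
  obtain ⟨b, hb0, hb⟩ : ∃ b : ℝ, 0 ≤ b ∧
      ∀ s a s', ‖increment G (embedStack κ Θ ηstar) s a s'‖ ≤ b := by
    obtain ⟨b, hb⟩ := (Set.finite_range fun x : S × A × S =>
      ‖increment G (embedStack κ Θ ηstar) x.1 x.2.1 x.2.2‖).bddAbove
    exact ⟨max b 0, le_max_right _ _, fun s a s' =>
      (hb (Set.mem_range_self (s, a, s'))).trans (le_max_left _ _)⟩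
  have hS : 0 < (Fintype.card S : ℝ) := by
    have : Nonempty S := by
      by_contra h
      rw [not_nonempty_iff] at h
      simpa using hν₀.2
    exact_mod_cast Fintype.card_pos
  have hl := hlam.1
  obtain ⟨δ, hδ, hδ1, hδρ⟩ : ∃ δ : ℝ, 0 < δ ∧ δ ≤ 1 ∧ 2 * δ ≤ rhoMin H M π ν₀ :=
    ⟨min (rhoMin H M π ν₀ / 2) 1, lt_min (by positivity) one_pos, min_le_right _ _,
      by linarith [min_le_left (rhoMin H M π ν₀ / 2) 1]⟩
  have hphase : ∀ (t : Fin H) (x : S), 2 * δ ≤ phaseLaw M π ν₀ t x := fun t x =>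
    hδρ.trans (ciInf_le (f := fun x : Fin H × S => phaseLaw M π ν₀ x.1 x.2)
      (Set.finite_range _).bddBelow (t, x))
  set L : ℝ := H * Fintype.card S * (64 / δ ^ H) with hL
  have hL0 : 0 < L := by positivity
  -- the total step of an episode has to be at most `1 / 4` to control the drift, and small enough
  -- for the second order term to use up at most a quarter of the contraction rate
  set αbar : ℝ := min (1 / (4 * H)) (δ / 2 / (H * L)) with hαbar
  have hαbar0 : 0 < αbar := by positivity
  have hα1 : H * αbar ≤ 1 / 4 := by
    have := mul_le_mul_of_nonneg_left (min_le_left (1 / (4 * (H : ℝ))) (δ / 2 / (H * L)))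
      (by linarith : (0 : ℝ) ≤ H)
    refine this.trans (le_of_eq ?_)
    field_simp
  have hα2 : H * αbar * L ≤ δ / 2 := by
    have := mul_le_mul_of_nonneg_left (min_le_right (1 / (4 * (H : ℝ))) (δ / 2 / (H * L)))
      (by positivity : (0 : ℝ) ≤ H * L)
    rw [mul_div_cancel₀ _ (by positivity)] at this
    linarith
  set c : ℝ := δ / 2 with hc
  have hc0 : 0 < c := by positivity
  have hcH : c * H * αbar < 1 := by
    have : c * (H * αbar) ≤ c * (1 / 4) := by gcongr
    linarith
  set B : ℝ := 16 * H * Fintype.card S * b ^ 2 with hB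
  have hB0 : 0 ≤ B := by positivity
  set K₁ : ℝ := 1 / δ ^ H with hK₁
  set K₂ : ℝ := H * Fintype.card S / (lam ^ H) ^ 2 with hK₂
  have hK₁0 : 0 < K₁ := by positivity
  have hK₂0 : 0 < K₂ := by positivity
  have h1 : 0 ≤ K₁ * (B * H / c) := by positivity
  have h2 : 0 ≤ K₁ * (B * H ^ 3) := by positivity
  have h3 : 0 ≤ K₁ * (2 * B * H ^ 3 / c) := by positivity
  have h4 : 0 < K₁ * K₂ := by positivity
  set C : ℝ := K₁ * K₂ + K₁ * (B * H / c) + K₁ * (B * H ^ 3) + K₁ * (2 * B * H ^ 3 / c) with hC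
  refine ⟨C, c, αbar, by linarith, hc0, hαbar0, hcH, ?_⟩
  intro Ω _ μ _ ep hep η₀ hη₀
  set ℓ := blockDist κ lam η₀ ηstar with hℓ
  have hstar : ηstar ∈ categoricalStacks Θ := hK.fixedStack_mem hd hπ
  -- `x m` is the mean Lyapunov function at the start of episode `m`
  have key : ∀ a : ℕ → ℝ, (∀ k, 0 ≤ a k) → (∀ k, a k ≤ αbar) → ∃ x : ℕ → ℝ, (∀ m, 0 ≤ x m) ∧
      (∀ m, x (m + 1) ≤ (1 - c * ∑ t ∈ Finset.range H, a (m * H + t)) * x m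
        + B * (∑ t ∈ Finset.range H, a (m * H + t)) ^ 2) ∧
      ∀ m Q D r, 0 ≤ Q → 0 ≤ r → K₁ * D ≤ C → x m ≤ x 0 * Q + D * r →
        MeanSqLE μ (fun ω => boundaryError κ lam Θ M ηstar η₀ a (fun j => ep j ω) m)
          (C * ℓ ^ 2 * Q + C * r) := by
    intro a ha haα
    have hsum : ∀ m, ∑ t ∈ Finset.range H, a (m * H + t) ≤ H * αbar := fun m => by
      simpa using Finset.sum_le_card_nsmul (Finset.range H) _ _ fun t _ => haα (m * H + t)
    refine ⟨fun m => ∫ ω, lyapunov δ (iterate κ Θ M a (embedStack κ Θ η₀) (fun j => ep j ω) (m * H)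
        - embedStack κ Θ ηstar) ∂μ,
      fun m => integral_nonneg fun ω => lyapunov_nonneg hδ.le _, fun m => ?_,
      fun m Q D r hQ hr hD hx => ?_⟩
    · exact hG.integral_lyapunov_le hπ hν₀ hb hb0 hδ hδ1 hphase hep ⟨η₀, hη₀, rfl⟩ ha
        ((hsum m).trans hα1) ((mul_le_mul_of_nonneg_right (hsum m) hL0.le).trans hα2)
    · refine (hK.meanSqLE_boundaryError hd hπ hΘ hl.le hlam.2.le hδ hδ1 hep hη₀ m).mono ?_
      have hx0 : ∫ ω, lyapunov δ (iterate κ Θ M a (embedStack κ Θ η₀) (fun j => ep j ω) (0 * H)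
          - embedStack κ Θ ηstar) ∂μ ≤ K₂ * ℓ ^ 2 := by
        simp only [Nat.zero_mul, iterate, integral_const, probReal_univ, one_smul]
        have := lyapunov_le hδ.le hδ1 fun i s => pow_le_pow_left₀ (norm_nonneg _)
          (hK.norm_block_le_blockDist hΘ hη₀ hstar hl hlam.2.le i s) 2
        refine this.trans (le_of_eq ?_)
        rw [hK₂, hℓ]
        ring
      have h5 := mul_le_mul_of_nonneg_left (hx.trans
        (add_le_add_left (mul_le_mul_of_nonneg_right hx0 hQ) _)) hK₁0.le
      refine h5.trans ?_
      have h6 : K₁ * K₂ ≤ C := by linarith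
      calc _ = (K₁ * K₂) * ℓ ^ 2 * Q + (K₁ * D) * r := by ring
        _ ≤ _ := by gcongr
  refine ⟨fun α hα hαle m => ?_, fun α g hα hg m => ?_, fun α g z hα hz0 hz1 hg m => ?_⟩
  · obtain ⟨x, hx0, hx, hx'⟩ := key (fun _ => α) (fun _ => hα.le) fun _ => hαle
    have hcα : c * H * α ≤ 1 := le_trans (by gcongr) hcH.le
    exact hx' m _ _ _ (pow_nonneg (sub_nonneg.2 hcα) m) hα.le (by linarith)
      (recursion_const hx (hx0 0) hc0 hB0 hHpos hα (fun _ => by simp) hcα m)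
  · have hg1 : 1 ≤ g := (le_max_left _ _).trans hg
    have hα0 : 0 < α := (by positivity : 0 < 1 / c).trans hα
    have hgα : α / αbar ≤ g := (le_max_right _ _).trans hg
    rw [div_le_iff₀ hαbar0] at hgα
    have hk : ∀ k : ℕ, 0 < (k : ℝ) + g := fun k => by positivity
    obtain ⟨x, hx0, hx, hx'⟩ := key (fun k => α / (k + g)) (fun k => div_nonneg hα0.le (hk k).le)
      fun k => by
        rw [div_le_iff₀ (hk k)]
        have : 0 ≤ (k : ℝ) * αbar := by positivity
        linarith
    have hcα : c * H * α ≤ g := by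
      calc c * H * α ≤ c * H * (g * αbar) := by gcongr
        _ = (c * H * αbar) * g := by ring
        _ ≤ 1 * g := by gcongr
        _ = g := one_mul g
    have hcα1 : 0 ≤ c * α - 1 := by
      rw [div_lt_iff₀ hc0] at hα; linarith
    have hτ : ∀ m, 0 < tau H g m := fun m => by linarith [le_tau hHpos g m]
    have := hx' m _ _ _ (Real.rpow_nonneg (div_pos (hτ 0) (hτ m)).le _)
      (mul_nonneg (div_nonneg (sq_nonneg α) hcα1) (one_div_pos.2 (hτ m)).le) (by linarith)
      (recursion_linear hx hx0 hc0 hB0 hHpos hα hg1 (fun _ => rfl) hcα m)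
    exact this.mono (le_of_eq (by ring))
  · have hg1 : 1 ≤ g := (le_max_left _ _).trans hg
    have hg2 := (le_max_left _ _).trans ((le_max_right _ _).trans hg)
    have hg3 := (le_max_right _ _).trans ((le_max_right _ _).trans hg)
    have hg0 : 0 < g := by linarith
    have hz1' : 0 < 1 - z := sub_pos.2 hz1
    have hgα : α / αbar ≤ g ^ z := by
      have := Real.rpow_le_rpow (by positivity) hg2 hz0.le
      rwa [← Real.rpow_mul (by positivity), one_div_mul_cancel hz0.ne', Real.rpow_one] at this
    have hgz : 2 * z / (c * α) ≤ g ^ (1 - z) := by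
      have := Real.rpow_le_rpow (by positivity) hg3 hz1'.le
      rwa [← Real.rpow_mul (by positivity), one_div_mul_cancel hz1'.ne', Real.rpow_one] at this
    rw [div_le_iff₀ hαbar0] at hgα
    have hk : ∀ k : ℕ, 0 < (k : ℝ) + g := fun k => by positivity
    obtain ⟨x, hx0, hx, hx'⟩ := key (fun k => α / (k + g) ^ z)
      (fun k => div_nonneg hα.le (Real.rpow_nonneg (hk k).le z)) fun k => by
        rw [div_le_iff₀ (Real.rpow_pos_of_pos (hk k) z), mul_comm]
        refine hgα.trans (mul_le_mul_of_nonneg_right ?_ hαbar0.le)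
        exact Real.rpow_le_rpow hg0.le (by linarith [k.cast_nonneg (α := ℝ)]) hz0.le
    have hcα : c * H * α ≤ g ^ z := by
      calc c * H * α ≤ c * H * (g ^ z * αbar) := by gcongr
        _ = (c * H * αbar) * g ^ z := by ring
        _ ≤ 1 * g ^ z := by gcongr
        _ = g ^ z := one_mul _
    have hτ : 0 < tau H g m := by linarith [le_tau hHpos g m]
    have := hx' m _ _ _ (Real.exp_pos _).le (div_nonneg hα.le (Real.rpow_nonneg hτ.le z))
      (by linarith)
      (recursion_poly hx hx0 hc0 hB0 hHpos hα hz0 hz1 hg1 (fun _ => rfl) hcα hgz m)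
    exact this.mono (le_of_eq (by ring))
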